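/- Fix an alphabet $\Sigma$ (finite or infinite). **Ipomsets.** A labelled iposet $(P,<,\dashrightarrow,S,T,\lambda)$ is a finite set $P$ with two strict partial orders, the precedence order $<$ and the event order $\dashrightarrow$, such that any two distinct elements are comparable by $<$ or by $\dashrightarrow$, a labelling $\lambda:P\to\Sigma$, and sets $S,T\subseteq P$ (source and target interface) of $<$-minimal, respectively $<$-maximal, elements. A subsumption $P\to Q$ is a label-preserving bijection $f$ with $f(S_P)=S_Q$, $f(T_P)=T_Q$, such that $f(x)<_Q f(y)$ implies $x<_P y$, and such that $x\dashrightarrow_P y$ implies $f(x)\dashrightarrow_Q f(y)$ for $<_P$-incomparable $x,y$; we write $P\sqsubseteq Q$ if one exists. An isomorphism is a subsumption that also preserves $<$ (so only the event order of $<$-incomparable elements matters up to isomorphism). An ipomset is an isomorphism class of labelled iposets; it is an interval ipomset if there are $b,e:P\to\mathbb R$ with $b\le e$ and $x<y\iff e(x)<b(y)$. For finite totally ordered labelled sets (lo-sets) write $\simeq$ for isomorphism. If $T_P\simeq S_Q$ (as lo-sets ordered by $\dashrightarrow$), the gluing $P*Q$ is the quotient of $P\sqcup Q$ identifying $T_P$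 with $S_Q$ along the unique isomorphism, with interfaces $S_P$ and $T_Q$, event order the transitive closure of $\dashrightarrow_P\cup\dashrightarrow_Q$, and $x<y$ iff $x<_Py$, or $x<_Qy$, or $x\in P\setminus T_P$ and $y\in Q\setminus S_Q$. **Languages.** A language is a set $L$ of interval ipomsets such that $P\sqsubseteq Q\in L$ implies $P\in L$ for interval ipomsets $P$. Put $L*M=\{R \text{ an interval ipomset}\mid R\sqsubseteq P*Q \text{ for some } P\in L,\ Q\in M \text{ with } T_P\simeq S_Q\}$, $L^1=L$, $L^{n+1}=L*L^n$; the Kleene plus of $L$ is $L^+=\bigcup_{n\ge1}L^n$. **HDAs.** Let $\square$ be the category whose objects are the words over $\Sigma$ (isomorphism classes of lo-sets), and whose morphisms $d_{A,B}:U\to V$ are given by disjoint sets $A,B$ of events of $V$ together with an order- and label-preserving map $\partial:U\to V$ with image $V\setminus(A\cup B)$; the composite of $d_{A,B}:U\to V$ with $d_{C,D}:V\to W$, whose underlying map is $\partial'$, is $d_{\partial'(A)\cup C,\,\partial'(B)\cup D}$. A higher-dimensional automaton (HDA) is a presheaf $X:\square^{\mathrm{op}}\to\mathrm{Set}$ with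 finitely many cells (elements of the sets $X[U]$), together with arbitrary sets of start cells and of accept cells. A path in $X$ is a sequence of cells $x_0,\dots,x_n$ ($n\ge 0$) joined by up-steps from $\delta^0_A(x)=X[d_{A,\emptyset}](x)$ to $x$ and down-steps from $x$ to $\delta^1_B(x)=X[d_{\emptyset,B}](x)$. For $x\in X[U]$, the ipomset of an up-step $\delta^0_A(x)\to x$ is the discrete ipomset $U$ (empty $<$) with $S=U\setminus A$, $T=U$; that of a down-step $x\to\delta^1_B(x)$ is the discrete ipomset $U$ with $S=U$, $T=U\setminus B$; the path of length $0$ at $x$ has the discrete ipomset $U$ with $S=T=U$; the ipomset of a path of positive length is the gluing of the ipomsets of its steps. A set of ipomsets is regular if it is the set of ipomsets of all paths of some HDA that lead from a start cell to an accept cell. **Proposition.** If $L$ is regular, then its Kleene plus $L^+$ is a language, and it is regular. -/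

import Mathlib

open CategoryTheory Opposite

universe u

namespace HDALang

/-! ### Lo-sets and the labelled precube category -/

/-- A lo-set up to isomorphism, that is, a word over the alphabet `α`: the events are the elements
of `Fin size`, the event order is the order of `Fin size`. -/
structure LoSet (α : Type u) where
  size : ℕ
  label : Fin size → α

/-- A coface map `d_{A,B} : U → V`: an order and label preserving map whose image is the
complement of `A ∪ B`, for disjoint sets `A` (events unstarted in `U`) and `B` (events terminated
in `U`) of events of `V`. -/
@[ext]
structure Coface {α : Type u} (U V : LoSet α) where
  map : Fin U.size ↪o Fin V.size
  A : Set (Fin V.size)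
  B : Set (Fin V.size)
  label_map : ∀ i, V.label (map i) = U.label i
  disjoint : Disjoint A B
  compl_range : (Set.range map)ᶜ = A ∪ B

namespace Coface

variable {α : Type u}

/-- The identity `d_{∅,∅}`. -/
def id (U : LoSet α) : Coface U U where
  map := RelEmbedding.refl _
  A := ∅
  B := ∅
  label_map _ := rfl
  disjoint := by simp
  compl_range := by ext; simp

/-- `d_{C,D} ∘ d_{A,B} = d_{∂(A) ∪ C, ∂(B) ∪ D}`, where `∂` is the map underlying `d_{C,D}`. -/
def comp {U V W : LoSet α} (d : Coface U V) (e : Coface V W) : Coface U W where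
  map := d.map.trans e.map
  A := e.map '' d.A ∪ e.A
  B := e.map '' d.B ∪ e.B
  label_map i := by simp [e.label_map, d.label_map]
  disjoint := by
    have hd := d.disjoint
    have he := e.disjoint
    have hr : ∀ i, e.map i ∉ e.A ∪ e.B := fun i hi => by
      rw [← e.compl_range] at hi
      exact hi ⟨i, rfl⟩
    rw [Set.disjoint_left] at *
    rintro x (⟨a, ha, rfl⟩ | ha) (⟨b, hb, hab⟩ | hb)
    · rw [e.map.injective hab] at hb
      exact hd ha hb
    · exact hr a (Or.inr hb)
    · subst hab
      exact hr b (Or.inl ha)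
    · exact he ha hb
  compl_range := by
    ext x
    have hd := fun y => Set.ext_iff.1 d.compl_range y
    have he := Set.ext_iff.1 e.compl_range x
    simp only [Set.mem_compl_iff, Set.mem_range, Set.mem_union, Set.mem_image,
      RelEmbedding.coe_trans, Function.comp_apply, not_exists] at *
    constructor
    · intro h
      by_cases hx : ∃ y, e.map y = x
      · obtain ⟨y, rfl⟩ := hx
        have : y ∈ d.A ∨ y ∈ d.B := (hd y).1 fun z hz => h z (by rw [hz])
        rcases this with h | h
        · exact Or.inl (Or.inl ⟨y, h, rfl⟩)
        · exact Or.inr (Or.inl ⟨y, h, rfl⟩)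
      · push Not at hx
        rcases he.1 hx with h | h
        · exact Or.inl (Or.inr h)
        · exact Or.inr (Or.inr h)
    · intro h z hz
      have key : ∀ y, (y ∈ d.A ∨ y ∈ d.B) → e.map y = x → False := fun y hy hyx => by
        rw [← hz] at hyx
        exact (hd y).2 hy z (e.map.injective hyx).symm
      have key' : (x ∈ e.A ∨ x ∈ e.B) → False := fun h => he.2 h _ hz
      rcases h with (⟨y, hy, hyx⟩ | h) | (⟨y, hy, hyx⟩ | h)
      · exact key y (Or.inl hy) hyx
      · exact key' (Or.inl h)
      · exact key y (Or.inr hy) hyx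
      · exact key' (Or.inr h)

end Coface

/-- The (skeletal) labelled precube category. -/
instance {α : Type u} : Category.{0} (LoSet α) where
  Hom U V := Coface U V
  id U := Coface.id U
  comp d e := Coface.comp d e
  id_comp d := by
    apply Coface.ext <;> simp [Coface.comp, Coface.id]
  comp_id d := by
    apply Coface.ext <;> simp [Coface.comp, Coface.id]
  assoc d e f := by
    apply Coface.ext
    · rfl
    · simp [Coface.comp, Set.image_union, Set.image_image, Set.union_assoc]
    · simp [Coface.comp, Set.image_union, Set.image_image, Set.union_assoc]

/-! ### Higher-dimensional automata -/

/-- A precubical set. -/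
abbrev PrecubicalSet (α : Type u) := (LoSet α)ᵒᵖ ⥤ Type

/-- The cells of a precubical set. -/
abbrev Cell {α : Type u} (X : PrecubicalSet α) := Σ U : LoSet α, X.obj (op U)

/-- A higher-dimensional automaton: a finite precubical set with start and accept cells. -/
structure HDA (α : Type u) where
  cells : PrecubicalSet α
  finite : Finite (Cell cells)
  start : Set (Cell cells)
  accept : Set (Cell cells)

/-! ### Labelled iposets and ipomsets -/

/-- Labelled posets with interfaces `S`, `T`, precedence order `prec` and event order `event`. -/
structure Iposet (α : Type u) where
  carrier : Type
  finite : Finite carrier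
  prec : carrier → carrier → Prop
  event : carrier → carrier → Prop
  S : Set carrier
  T : Set carrier
  label : carrier → α
  prec_irrefl : ∀ x, ¬ prec x x
  prec_trans : ∀ x y z, prec x y → prec y z → prec x z
  event_irrefl : ∀ x, ¬ event x x
  event_trans : ∀ x y z, event x y → event y z → event x z
  comparable : ∀ x y, x = y ∨ prec x y ∨ prec y x ∨ event x y ∨ event y x
  S_minimal : ∀ x ∈ S, ∀ y, ¬ prec y x
  T_maximal : ∀ x ∈ T, ∀ y, ¬ prec x y

namespace Iposet

variable {α : Type u}

/-- `f` is a subsumption of `P` by `Q`. -/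
structure IsSubsumption (P Q : Iposet α) (f : P.carrier ≃ Q.carrier) : Prop where
  src : f '' P.S = Q.S
  tgt : f '' P.T = Q.T
  label : ∀ x, Q.label (f x) = P.label x
  prec : ∀ x y, Q.prec (f x) (f y) → P.prec x y
  event : ∀ x y, P.event x y → ¬ P.prec x y → ¬ P.prec y x → Q.event (f x) (f y)

/-- `P ⊑ Q`: there is a subsumption from `P` to `Q`. -/
def Subsumed (P Q : Iposet α) : Prop := ∃ f, IsSubsumption P Q f

/-- `P ≅ Q`: there is a subsumption that is an isomorphism of precedence orders. By
`comparable`, such a map and its inverse both preserve the event order of concurrent events. -/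
def Isomorphic (P Q : Iposet α) : Prop :=
  ∃ f, IsSubsumption P Q f ∧ ∀ x y, P.prec x y → Q.prec (f x) (f y)

theorem IsSubsumption.trans {P Q R : Iposet α} {f : P.carrier ≃ Q.carrier}
    {g : Q.carrier ≃ R.carrier} (hf : IsSubsumption P Q f) (hg : IsSubsumption Q R g) :
    IsSubsumption P R (f.trans g) where
  src := by rw [← hg.src, ← hf.src, Set.image_image]; rfl
  tgt := by rw [← hg.tgt, ← hf.tgt, Set.image_image]; rfl
  label x := by simp [hg.label, hf.label]
  prec x y h := hf.prec _ _ (hg.prec _ _ h)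
  event x y h h1 h2 := hg.event _ _ (hf.event _ _ h h1 h2)
    (fun h => h1 (hf.prec _ _ h)) (fun h => h2 (hf.prec _ _ h))

theorem Subsumed.trans {P Q R : Iposet α} : P.Subsumed Q → Q.Subsumed R → P.Subsumed R :=
  fun ⟨f, hf⟩ ⟨g, hg⟩ => ⟨f.trans g, hf.trans hg⟩

theorem Isomorphic.subsumed {P Q : Iposet α} (h : P.Isomorphic Q) : P.Subsumed Q :=
  h.imp fun _ hf => hf.1

theorem Isomorphic.symm {P Q : Iposet α} : P.Isomorphic Q → Q.Isomorphic P := by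
  rintro ⟨f, hf, hp⟩
  refine ⟨f.symm, ⟨?_, ?_, fun x => ?_, fun x y h => ?_, fun x y h h1 h2 => ?_⟩, fun x y h => ?_⟩
  · rw [← hf.src, Set.image_image]; simp
  · rw [← hf.tgt, Set.image_image]; simp
  · rw [← hf.label, f.apply_symm_apply]
  · simpa using hp _ _ h
  · obtain ⟨a, rfl⟩ := f.surjective x
    obtain ⟨b, rfl⟩ := f.surjective y
    simp only [f.symm_apply_apply]
    have h1' : ¬ P.prec a b := fun h => h1 (hp _ _ h)
    have h2' : ¬ P.prec b a := fun h => h2 (hp _ _ h)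
    rcases P.comparable a b with e | e | e | e | e
    · subst e
      exact (Q.event_irrefl _ h).elim
    · exact (h1' e).elim
    · exact (h2' e).elim
    · exact e
    · exact (Q.event_irrefl _ (Q.event_trans _ _ _ h (hf.event _ _ e h2' h1'))).elim
  · exact hf.prec _ _ (by simpa using h)

instance isoSetoid (α : Type u) : Setoid (Iposet α) where
  r := Isomorphic
  iseqv :=
    { refl := fun P => ⟨Equiv.refl _, ⟨by simp, by simp, fun _ => rfl, fun _ _ h => h,
        fun _ _ h _ _ => h⟩, fun _ _ h => h⟩
      symm := Isomorphic.symm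
      trans := fun ⟨f, hf, hf'⟩ ⟨g, hg, hg'⟩ =>
        ⟨f.trans g, hf.trans hg, fun _ _ h => hg' _ _ (hf' _ _ h)⟩ }

/-- `P` admits an interval representation. -/
def IsInterval (P : Iposet α) : Prop :=
  ∃ b e : P.carrier → ℝ, (∀ x, b x ≤ e x) ∧ ∀ x y, P.prec x y ↔ e x < b y

theorem Isomorphic.isInterval {P Q : Iposet α} (h : P.Isomorphic Q) (hQ : Q.IsInterval) :
    P.IsInterval := by
  obtain ⟨f, hf, hp⟩ := h
  obtain ⟨b, e, hbe, hQ⟩ := hQ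
  exact ⟨b ∘ f, e ∘ f, fun x => hbe _,
    fun x y => ⟨fun h => (hQ _ _).1 (hp _ _ h), fun h => hf.prec _ _ ((hQ _ _).2 h)⟩⟩

/-! #### Gluing composition -/

/-- An isomorphism of lo-sets from the target interface of `P` to the source interface of `Q`. -/
structure Matching (P Q : Iposet α) where
  equiv : P.T ≃ Q.S
  event_iff : ∀ s t : P.T, P.event s t ↔ Q.event (equiv s) (equiv t)
  label_eq : ∀ t : P.T, Q.label (equiv t) = P.label t

section Glue

variable (P Q : Iposet α) (f : Matching P Q)

/-- The disjoint union of `P` and `Q` with `T_P` and `S_Q` identified along `f`: each class is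
represented by its unique element in `P` or `Q \ S_Q`. -/
abbrev GlueCarrier (P Q : Iposet α) : Type := P.carrier ⊕ {q : Q.carrier // q ∉ Q.S}

variable {P Q}

open Classical in
/-- The structural inclusion of `Q` into the gluing; that of `P` is `Sum.inl`. -/
noncomputable def Matching.inR (q : Q.carrier) : GlueCarrier P Q :=
  if h : q ∈ Q.S then Sum.inl (f.equiv.symm ⟨q, h⟩ : P.T) else Sum.inr ⟨q, h⟩

/-- `x` precedes `y` in the gluing. -/
def Matching.gluePrec (x y : GlueCarrier P Q) : Prop :=
  (∃ a b, P.prec a b ∧ Sum.inl a = x ∧ Sum.inl b = y) ∨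
  (∃ a b, Q.prec a b ∧ f.inR a = x ∧ f.inR b = y) ∨
  (∃ a b, a ∉ P.T ∧ b ∉ Q.S ∧ Sum.inl a = x ∧ f.inR b = y)

/-- The union of the event orders of `P` and `Q`. -/
def Matching.glueEventGen (x y : GlueCarrier P Q) : Prop :=
  (∃ a b, P.event a b ∧ Sum.inl a = x ∧ Sum.inl b = y) ∨
  (∃ a b, Q.event a b ∧ f.inR a = x ∧ f.inR b = y)

theorem Matching.inR_of_notMem {q : Q.carrier} (h : q ∉ Q.S) : f.inR q = Sum.inr ⟨q, h⟩ := by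
  simp [Matching.inR, h]

theorem Matching.inR_equiv (t : P.T) : f.inR (f.equiv t) = Sum.inl (t : P.carrier) := by
  simp [Matching.inR]

theorem Matching.inR_cases (q : Q.carrier) :
    (∃ h : q ∉ Q.S, f.inR q = Sum.inr ⟨q, h⟩) ∨
      ∃ t : P.T, q = f.equiv t ∧ f.inR q = Sum.inl (t : P.carrier) := by
  by_cases h : q ∈ Q.S
  · obtain ⟨t, ht⟩ := f.equiv.surjective ⟨q, h⟩
    have : q = f.equiv t := by rw [ht]
    exact Or.inr ⟨t, this, by rw [this, f.inR_equiv]⟩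
  · exact Or.inl ⟨h, f.inR_of_notMem h⟩

theorem Matching.inR_injective : Function.Injective f.inR := by
  intro p q h
  rcases f.inR_cases p with ⟨hp, ep⟩ | ⟨s, rfl, ep⟩ <;>
    rcases f.inR_cases q with ⟨hq, eq⟩ | ⟨t, rfl, eq⟩ <;> rw [ep, eq] at h
  · simpa using h
  · simp at h
  · simp at h
  · rw [Subtype.ext (Sum.inl_injective h)]

theorem Matching.inR_eq_inl {q : Q.carrier} {p : P.carrier} (h : f.inR q = Sum.inl p) :
    p ∈ P.T ∧ q ∈ Q.S := by
  rcases f.inR_cases q with ⟨hq, eq⟩ | ⟨t, rfl, eq⟩ <;> rw [eq] at h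
  · simp at h
  · rw [← Sum.inl_injective h]
    exact ⟨t.2, (f.equiv t).2⟩

/-- An explicit description of a relation containing the event order of the gluing. -/
def Matching.glueEventAux : GlueCarrier P Q → GlueCarrier P Q → Prop
  | Sum.inl a, Sum.inl b => P.event a b
  | Sum.inr p, Sum.inr q => Q.event p q
  | Sum.inl a, Sum.inr q => ∃ t : P.T, (a = t ∨ P.event a t) ∧ Q.event (f.equiv t) q
  | Sum.inr p, Sum.inl b => ∃ t : P.T, Q.event p (f.equiv t) ∧ ((t : P.carrier) = b ∨ P.event t b)

theorem Matching.glueEventAux_of_gen {x y : GlueCarrier P Q} (h : f.glueEventGen x y) :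
    f.glueEventAux x y := by
  rcases h with ⟨a, b, h, rfl, rfl⟩ | ⟨a, b, h, rfl, rfl⟩
  · exact h
  · rcases f.inR_cases a with ⟨ha, ea⟩ | ⟨s, rfl, ea⟩ <;>
      rcases f.inR_cases b with ⟨hb, eb⟩ | ⟨t, rfl, eb⟩ <;> rw [ea, eb]
    · exact h
    · exact ⟨t, h, Or.inl rfl⟩
    · exact ⟨s, Or.inl rfl, h⟩
    · exact (f.event_iff s t).2 h

theorem Matching.glueEventAux_trans {x y z : GlueCarrier P Q} (h1 : f.glueEventAux x y)
    (h2 : f.glueEventAux y z) : f.glueEventAux x z := by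
  have hP := P.event_trans
  have hQ := Q.event_trans
  have hf := f.event_iff
  have hQT : ∀ s t : P.T, Q.event (f.equiv s) (f.equiv t) → P.event s t :=
    fun s t => (hf s t).2
  have hPT : ∀ s t : P.T, ((s : P.carrier) = t ∨ P.event s t) → ∀ q p,
      Q.event q (f.equiv s) → Q.event (f.equiv t) p → Q.event q p := by
    rintro s t (h | h) q p hq hp
    · rw [Subtype.ext h] at hq
      exact hQ _ _ _ hq hp
    · exact hQ _ _ _ hq (hQ _ _ _ ((hf s t).1 h) hp)
  rcases x with a | p <;> rcases y with b | q <;> rcases z with c | r <;>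
    simp only [Matching.glueEventAux] at h1 h2 ⊢
  · exact hP _ _ _ h1 h2
  · obtain ⟨t, ht, hr⟩ := h2
    refine ⟨t, Or.inr ?_, hr⟩
    rcases ht with rfl | ht
    · exact h1
    · exact hP _ _ _ h1 ht
  · obtain ⟨s, hs, hq⟩ := h1
    obtain ⟨t, hq', ht⟩ := h2
    have hst := hQT _ _ (hQ _ _ _ hq hq')
    have h' : P.event s c := by
      rcases ht with rfl | ht
      · exact hst
      · exact hP _ _ _ hst ht
    rcases hs with rfl | hs
    · exact h'
    · exact hP _ _ _ hs h'
  · obtain ⟨s, hs, hq⟩ := h1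
    exact ⟨s, hs, hQ _ _ _ hq h2⟩
  · obtain ⟨t, hp, ht⟩ := h1
    refine ⟨t, hp, Or.inr ?_⟩
    rcases ht with rfl | ht
    · exact h2
    · exact hP _ _ _ ht h2
  · obtain ⟨s, hp, hs⟩ := h1
    obtain ⟨t, ht, hr⟩ := h2
    refine hPT s t ?_ _ _ hp hr
    rcases hs with hs | hs <;> rcases ht with ht | ht
    · exact Or.inl (hs.trans ht)
    · exact Or.inr (hs ▸ ht)
    · exact Or.inr (ht ▸ hs)
    · exact Or.inr (hP _ _ _ hs ht)
  · obtain ⟨t, hq, ht⟩ := h2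
    exact ⟨t, hQ _ _ _ h1 hq, ht⟩
  · exact hQ _ _ _ h1 h2

theorem Matching.gluePrec_trans {x y z : GlueCarrier P Q} (h1 : f.gluePrec x y)
    (h2 : f.gluePrec y z) : f.gluePrec x z := by
  rcases h1 with ⟨a, b, h1, rfl, e1⟩ | ⟨a, b, h1, rfl, e1⟩ | ⟨a, b, h1, h1', rfl, e1⟩ <;>
    rcases h2 with ⟨c, d, h2, e2, rfl⟩ | ⟨c, d, h2, e2, rfl⟩ | ⟨c, d, h2, h2', e2, rfl⟩ <;>
    have e := e1.trans e2.symm <;> clear e1 e2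
  · cases e
    exact Or.inl ⟨a, d, P.prec_trans _ _ _ h1 h2, rfl, rfl⟩
  · refine Or.inr (Or.inr ⟨a, d, fun ha => P.T_maximal a ha _ h1,
      fun hd => Q.S_minimal d hd _ h2, rfl, rfl⟩)
  · exact Or.inr (Or.inr ⟨a, d, fun ha => P.T_maximal a ha _ h1, h2', rfl, rfl⟩)
  · exact (Q.S_minimal b (f.inR_eq_inl e).2 _ h1).elim
  · cases f.inR_injective e
    exact Or.inr (Or.inl ⟨a, d, Q.prec_trans _ _ _ h1 h2, rfl, rfl⟩)
  · exact (Q.S_minimal b (f.inR_eq_inl e).2 _ h1).elim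
  · exact (h1' (f.inR_eq_inl e).2).elim
  · cases f.inR_injective e
    exact Or.inr (Or.inr ⟨a, d, h1, fun hd => Q.S_minimal d hd _ h2, rfl, rfl⟩)
  · exact (h1' (f.inR_eq_inl e).2).elim

/-- The gluing composition `P * Q` along the isomorphism `f` of `T_P` and `S_Q`. -/
noncomputable def glue (P Q : Iposet α) (f : Matching P Q) : Iposet α where
  carrier := GlueCarrier P Q
  finite := by
    have := P.finite
    have := Q.finite
    infer_instance
  prec := f.gluePrec
  event := Relation.TransGen f.glueEventGen
  S := Sum.inl '' P.S
  T := f.inR '' Q.T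
  label := Sum.elim P.label fun q => Q.label q
  prec_irrefl := by
    rintro x (⟨a, b, h, rfl, e⟩ | ⟨a, b, h, rfl, e⟩ | ⟨a, b, ha, hb, rfl, e⟩)
    · cases e
      exact P.prec_irrefl _ h
    · cases f.inR_injective e
      exact Q.prec_irrefl _ h
    · exact hb (f.inR_eq_inl e).2
  prec_trans _ _ _ h1 h2 := f.gluePrec_trans h1 h2
  event_irrefl := by
    intro x h
    have key : ∀ y, Relation.TransGen f.glueEventGen x y → f.glueEventAux x y := by
      intro y h
      induction h with
      | single h => exact f.glueEventAux_of_gen h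
      | tail _ h ih => exact f.glueEventAux_trans ih (f.glueEventAux_of_gen h)
    have := key x h
    rcases x with a | q
    · exact P.event_irrefl _ this
    · exact Q.event_irrefl _ this
  event_trans _ _ _ h1 h2 := h1.trans h2
  comparable := by
    have hq : ∀ q : {q : Q.carrier // q ∉ Q.S}, f.inR q = Sum.inr q :=
      fun q => f.inR_of_notMem q.2
    have hQ : ∀ p q : Q.carrier, f.inR p = f.inR q ∨ f.gluePrec (f.inR p) (f.inR q) ∨
        f.gluePrec (f.inR q) (f.inR p) ∨
        Relation.TransGen f.glueEventGen (f.inR p) (f.inR q) ∨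
        Relation.TransGen f.glueEventGen (f.inR q) (f.inR p) := by
      intro p q
      rcases Q.comparable p q with e | e | e | e | e
      · exact Or.inl (by rw [e])
      · exact Or.inr (Or.inl (Or.inr (Or.inl ⟨p, q, e, rfl, rfl⟩)))
      · exact Or.inr (Or.inr (Or.inl (Or.inr (Or.inl ⟨q, p, e, rfl, rfl⟩))))
      · exact Or.inr (Or.inr (Or.inr (Or.inl (.single (Or.inr ⟨p, q, e, rfl, rfl⟩)))))
      · exact Or.inr (Or.inr (Or.inr (Or.inr (.single (Or.inr ⟨q, p, e, rfl, rfl⟩)))))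
    rintro (a | p) (b | q)
    · rcases P.comparable a b with e | e | e | e | e
      · exact Or.inl (by rw [e])
      · exact Or.inr (Or.inl (Or.inl ⟨a, b, e, rfl, rfl⟩))
      · exact Or.inr (Or.inr (Or.inl (Or.inl ⟨b, a, e, rfl, rfl⟩)))
      · exact Or.inr (Or.inr (Or.inr (Or.inl (.single (Or.inl ⟨a, b, e, rfl, rfl⟩)))))
      · exact Or.inr (Or.inr (Or.inr (Or.inr (.single (Or.inl ⟨b, a, e, rfl, rfl⟩)))))
    · by_cases ha : a ∈ P.T
      · have := hQ (f.equiv ⟨a, ha⟩) q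
        rwa [hq, f.inR_equiv] at this
      · exact Or.inr (Or.inl (Or.inr (Or.inr ⟨a, q, ha, q.2, rfl, hq q⟩)))
    · by_cases hb : b ∈ P.T
      · have := hQ p (f.equiv ⟨b, hb⟩)
        rwa [hq, f.inR_equiv] at this
      · exact Or.inr (Or.inr (Or.inl (Or.inr (Or.inr ⟨b, p, hb, p.2, rfl, hq p⟩))))
    · have := hQ p q
      rwa [hq, hq] at this
  S_minimal := by
    rintro _ ⟨s, hs, rfl⟩ y (⟨a, b, h, rfl, e⟩ | ⟨a, b, h, rfl, e⟩ | ⟨a, b, ha, hb, rfl, e⟩)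
    · cases e
      exact P.S_minimal _ hs _ h
    · exact Q.S_minimal _ (f.inR_eq_inl e).2 _ h
    · exact hb (f.inR_eq_inl e).2
  T_maximal := by
    rintro _ ⟨t, ht, rfl⟩ y (⟨a, b, h, e, rfl⟩ | ⟨a, b, h, e, rfl⟩ | ⟨a, b, ha, hb, e, rfl⟩)
    · exact P.T_maximal _ (f.inR_eq_inl e.symm).1 _ h
    · cases f.inR_injective e
      exact Q.T_maximal _ ht _ h
    · exact ha (f.inR_eq_inl e.symm).1

end Glue

/-- The discrete iposet on the lo-set `U` with source interface `S` and target interface `T`. -/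
def discrete (U : LoSet α) (S T : Set (Fin U.size)) : Iposet α where
  carrier := Fin U.size
  finite := inferInstance
  prec _ _ := False
  event i j := i < j
  S := S
  T := T
  label := U.label
  prec_irrefl _ h := h
  prec_trans _ _ _ h _ := h
  event_irrefl := lt_irrefl
  event_trans _ _ _ := lt_trans
  comparable x y := by
    rcases lt_trichotomy x y with h | h | h <;> simp [h]
  S_minimal _ _ _ h := h
  T_maximal _ _ _ h := h

/-- An isomorphism of lo-sets from `U` to a set `I` of events (an interface) of `P`. -/
structure Marking (U : LoSet α) (P : Iposet α) (I : Set P.carrier) where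
  equiv : Fin U.size ≃ I
  event_iff : ∀ i j, i < j ↔ P.event (equiv i) (equiv j)
  label_eq : ∀ i, P.label (equiv i) = U.label i

/-- The whole of a lo-set, marked by itself. -/
def Marking.univ (U : LoSet α) (S T : Set (Fin U.size)) :
    Marking U (discrete U S T) (Set.univ : Set (Fin U.size)) where
  equiv := (Equiv.Set.univ _).symm
  event_iff _ _ := Iff.rfl
  label_eq _ := rfl

/-- The image of a coface map, marked by the source of that map. -/
noncomputable def Marking.range {U V : LoSet α} (d : Coface U V) (S T : Set (Fin V.size)) :
    Marking U (discrete V S T) (Set.range d.map) where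
  equiv := Equiv.ofInjective d.map d.map.injective
  event_iff _ _ := d.map.lt_iff_lt.symm
  label_eq i := d.label_map i

/-- Interfaces isomorphic to the same lo-set match. -/
def Marking.matching {U : LoSet α} {P Q : Iposet α} (s : Marking U P P.T) (t : Marking U Q Q.S) :
    Matching P Q where
  equiv := s.equiv.symm.trans t.equiv
  event_iff x y := by
    obtain ⟨i, rfl⟩ := s.equiv.surjective x
    obtain ⟨j, rfl⟩ := s.equiv.surjective y
    simp [← s.event_iff, ← t.event_iff]
  label_eq x := by
    obtain ⟨i, rfl⟩ := s.equiv.surjective x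
    simp [s.label_eq, t.label_eq]

/-- The source interface of a gluing is that of its first factor. -/
noncomputable def Marking.glue {U : LoSet α} {P Q : Iposet α} (s : Marking U P P.S)
    (f : Matching P Q) : Marking U (P.glue Q f) (P.glue Q f).S where
  equiv := s.equiv.trans (Equiv.Set.image Sum.inl P.S Sum.inl_injective)
  event_iff i j := by
    rw [s.event_iff]
    refine ⟨fun h => .single (Or.inl ⟨_, _, h, rfl, rfl⟩), fun h => ?_⟩
    rcases lt_trichotomy i j with hij | rfl | hij
    · exact (s.event_iff _ _).1 hij
    · exact ((P.glue Q f).event_irrefl _ h).elim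
    · have h' : (P.glue Q f).event (Sum.inl (s.equiv j)) (Sum.inl (s.equiv i)) :=
        .single (Or.inl ⟨_, _, (s.event_iff _ _).1 hij, rfl, rfl⟩)
      exact ((P.glue Q f).event_irrefl _ ((P.glue Q f).event_trans _ _ _ h h')).elim
  label_eq i := s.label_eq i

end Iposet

/-- Ipomsets: isomorphism classes of labelled iposets. -/
def Ipomset (α : Type u) := Quotient (Iposet.isoSetoid α)

namespace Ipomset

variable {α : Type u}

/-- The ipomset of a labelled iposet. -/
def mk (P : Iposet α) : Ipomset α := Quotient.mk _ P

/-- `P` is an interval ipomset. -/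
def IsInterval (P : Ipomset α) : Prop :=
  Quotient.lift Iposet.IsInterval
    (fun P Q (h : P.Isomorphic Q) => propext ⟨h.symm.isInterval, h.isInterval⟩) P

/-- `P ⊑ Q`. -/
def Subsumed (P Q : Ipomset α) : Prop :=
  Quotient.lift₂ Iposet.Subsumed
    (fun P Q P' Q' (h : P.Isomorphic P') (h' : Q.Isomorphic Q') => propext
      ⟨fun k => (h.symm.subsumed.trans k).trans h'.subsumed,
        fun k => (h.subsumed.trans k).trans h'.symm.subsumed⟩) P Q

/-- `R = P * Q`; in particular `P * Q` is defined, i.e. `T_P ≃ S_Q`. -/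
def IsGluing (P Q R : Ipomset α) : Prop :=
  ∃ (p q : Iposet α) (f : Iposet.Matching p q), mk p = P ∧ mk q = Q ∧ mk (p.glue q f) = R

/-! ### Languages -/

/-- The down-closure of a set of ipomsets, within the interval ipomsets. -/
def downClosure (A : Set (Ipomset α)) : Set (Ipomset α) :=
  {P | P.IsInterval ∧ ∃ Q ∈ A, P.Subsumed Q}

/-- A language: a set of interval ipomsets that is down-closed (among interval ipomsets). -/
def IsLanguage (L : Set (Ipomset α)) : Prop :=
  (∀ P ∈ L, P.IsInterval) ∧ ∀ P Q : Ipomset α, P.IsInterval → P.Subsumed Q → Q ∈ L → P ∈ L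

/-- The gluing composition `L * M` of languages. -/
def langGlue (L M : Set (Ipomset α)) : Set (Ipomset α) :=
  downClosure {R | ∃ P ∈ L, ∃ Q ∈ M, IsGluing P Q R}

/-- `langPow L n` is `L ^ (n + 1)`. -/
def langPow (L : Set (Ipomset α)) : ℕ → Set (Ipomset α)
  | 0 => L
  | n + 1 => langGlue L (langPow L n)

/-- The Kleene plus, the union of all `L ^ n` with `n ≥ 1`. -/
def kleenePlus (L : Set (Ipomset α)) : Set (Ipomset α) := ⋃ n, langPow L n

end Ipomset

/-! ### Paths and their ipomsets -/

section Paths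

variable {α : Type u}

/-- Steps in a precubical set: up-steps along `d_{A,∅}` from a lower face to a cell, and down-steps
along `d_{∅,B}` from a cell to an upper face. -/
inductive Step (X : PrecubicalSet α) : Cell X → Cell X → Type u
  | up {U V : LoSet α} (x : X.obj (op U)) (y : X.obj (op V)) (d : U ⟶ V)
      (hd : Coface.B d = ∅) (h : X.map d.op y = x) : Step X ⟨U, x⟩ ⟨V, y⟩
  | down {U V : LoSet α} (x : X.obj (op U)) (y : X.obj (op V)) (d : V ⟶ U)
      (hd : Coface.A d = ∅) (h : X.map d.op x = y) : Step X ⟨U, x⟩ ⟨V, y⟩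

/-- Paths in a precubical set: finite sequences of consecutive steps. -/
inductive HPath (X : PrecubicalSet α) : Cell X → Cell X → Type u
  | nil (x : Cell X) : HPath X x x
  | cons {x y z : Cell X} (s : Step X x y) (p : HPath X y z) : HPath X x z

/-- The iposet of a step. For an up-step inserting `A` into `V \ A` it is the discrete iposet `V`
with source interface `V \ A` and target interface `V`; for a down-step removing `B` from `U` it is
`U` with source interface `U` and target interface `U \ B`. -/
noncomputable def Step.ev {X : PrecubicalSet α} {x y : Cell X} : Step X x y → Iposet α
  | @Step.up _ _ _ V _ _ d _ _ => Iposet.discrete V (Set.range (Coface.map d)) Set.univ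
  | @Step.down _ _ U _ _ _ d _ _ => Iposet.discrete U Set.univ (Set.range (Coface.map d))

/-- The source interface of the iposet of a step consists of the events of its source cell. -/
noncomputable def Step.src {X : PrecubicalSet α} {x y : Cell X} :
    (s : Step X x y) → Iposet.Marking x.1 s.ev s.ev.S
  | .up _ _ d _ _ => Iposet.Marking.range d _ _
  | .down _ _ _ _ _ => Iposet.Marking.univ _ _ _

/-- The target interface of the iposet of a step consists of the events of its target cell. -/
noncomputable def Step.tgt {X : PrecubicalSet α} {x y : Cell X} :
    (s : Step X x y) → Iposet.Marking y.1 s.ev s.ev.T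
  | .up _ _ _ _ _ => Iposet.Marking.univ _ _ _
  | .down _ _ d _ _ => Iposet.Marking.range d _ _

/-- The iposet `ev(α)` of a path, with the isomorphism from the events of the source cell of the
path to the source interface. A path of length `0` yields the identity on the events of its cell,
other paths yield the gluing of their steps (the last factor, an identity, is neutral). -/
noncomputable def HPath.evAux {X : PrecubicalSet α} {x y : Cell X} :
    HPath X x y → Σ P : Iposet α, Iposet.Marking x.1 P P.S
  | .nil x => ⟨Iposet.discrete x.1 Set.univ Set.univ, Iposet.Marking.univ _ _ _⟩
  | .cons s p =>
    ⟨s.ev.glue p.evAux.1 (s.tgt.matching p.evAux.2), s.src.glue (s.tgt.matching p.evAux.2)⟩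

/-- The ipomset `ev(α)` of a path. -/
noncomputable def HPath.ev {X : PrecubicalSet α} {x y : Cell X} (p : HPath X x y) : Ipomset α :=
  Ipomset.mk p.evAux.1

/-- The set of ipomsets of accepting paths of an HDA. -/
def HDA.lang (X : HDA α) : Set (Ipomset α) :=
  {P | ∃ x ∈ X.start, ∃ y ∈ X.accept, ∃ p : HPath X.cells x y, p.ev = P}

/-- `L` is regular: it is recognised by an HDA. -/
def IsRegular (L : Set (Ipomset α)) : Prop := ∃ X : HDA α, X.lang = L

end Paths

end HDALang

/-!
The ipomset of a path only depends on its word of starts and terminations. Every interval ipomset is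
the ipomset of a word, and subsumption of ipomsets is alignment of words: events may be started
later and terminated earlier. As subsumption is compatible with gluing, `L⁺` consists of the words
aligned with a concatenation of words accepted by `X`.

A run over such a word is a run over the concatenation that lags behind or is ahead of the word. Its
state is a virtual cell, a cell of `X` with a coface map recording the delayed and the already
terminated events; jumping from an accept cell to a start cell, and starting or terminating events
in the cell of `X` alone, are silent moves. An automaton has no silent moves of its own, and
absorbing them into the faces breaks the precubical identities. Therefore a cell of the new
automaton assigns a virtual cell to each of its faces, compatibly with upper faces, while passing to
lower faces may hide silent moves.
-/

namespace HDALang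

variable {α : Type u}

/-! ### Coface maps -/

namespace Coface

variable {U U' V V' W : LoSet α}

theorem mem_range_map_iff (d : Coface U V) (k : Fin V.size) :
    k ∈ Set.range d.map ↔ k ∉ d.A ∧ k ∉ d.B := by
  rw [← not_or, ← Set.mem_union, ← d.compl_range, Set.notMem_compl_iff]

theorem map_notMem_A (d : Coface U V) (i : Fin U.size) : d.map i ∉ d.A :=
  ((d.mem_range_map_iff _).1 ⟨i, rfl⟩).1

theorem map_notMem_B (d : Coface U V) (i : Fin U.size) : d.map i ∉ d.B :=
  ((d.mem_range_map_iff _).1 ⟨i, rfl⟩).2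

@[simp] theorem id_B : Coface.B (𝟙 U : U ⟶ U) = ∅ := rfl

@[simp] theorem comp_map (d : U ⟶ V) (e : V ⟶ W) (i : Fin U.size) :
    Coface.map (d ≫ e) i = Coface.map e (Coface.map d i) := rfl

theorem comp_A (d : U ⟶ V) (e : V ⟶ W) :
    Coface.A (d ≫ e) = Coface.map e '' Coface.A d ∪ Coface.A e := rfl

theorem comp_B (d : U ⟶ V) (e : V ⟶ W) :
    Coface.B (d ≫ e) = Coface.map e '' Coface.B d ∪ Coface.B e := rfl

theorem A_eq_compl_range_sdiff (d : Coface U V) : d.A = (Set.range d.map)ᶜ \ d.B := by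
  rw [d.compl_range]
  exact d.disjoint.sup_sdiff_cancel_right.symm

theorem B_eq_compl_range {b : Coface U V} (hb : b.A = ∅) : b.B = (Set.range b.map)ᶜ := by
  rw [b.compl_range, hb, Set.empty_union]

theorem ext_map_B {d e : Coface U V} (h : ∀ i, d.map i = e.map i) (hB : d.B = e.B) : d = e := by
  have hm : d.map = e.map := RelEmbedding.ext h
  exact Coface.ext hm (by rw [A_eq_compl_range_sdiff, A_eq_compl_range_sdiff, hm, hB]) hB

/-- The coface map with underlying map `g` and set of terminated events `B`: the remaining events
outside the image of `g` are the unstarted ones. -/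
def ofMap (g : Fin U.size → Fin V.size) (hg : StrictMono g)
    (hl : ∀ i, V.label (g i) = U.label i) (B : Set (Fin V.size)) (hB : ∀ i, g i ∉ B) :
    Coface U V where
  map := OrderEmbedding.ofStrictMono g hg
  A := (Set.range g)ᶜ \ B
  B := B
  label_map := hl
  disjoint := Set.disjoint_sdiff_left
  compl_range := by
    have hB' : B ⊆ (Set.range g)ᶜ := by
      rintro _ hk ⟨i, rfl⟩
      exact hB i hk
    exact (Set.sdiff_union_of_subset hB').symm

theorem exists_comp_eq_of_subset (c : W ⟶ V) (a : U ⟶ V) (hA : Coface.A a ⊆ Coface.A c)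
    (hB : Coface.B a ⊆ Coface.B c) : ∃ c' : W ⟶ U, c' ≫ a = c := by
  have hr : ∀ i, ∃ j, Coface.map a j = Coface.map c i := fun i =>
    (a.mem_range_map_iff _).2
      ⟨fun h => c.map_notMem_A i (hA h), fun h => c.map_notMem_B i (hB h)⟩
  choose g hg using hr
  let c' : Coface W U := ofMap g
    (fun i j hij => by rwa [← (Coface.map a).lt_iff_lt, hg, hg, (Coface.map c).lt_iff_lt])
    (fun i => by rw [← a.label_map, hg, c.label_map])
    (Coface.map a ⁻¹' Coface.B c) (fun i => by simpa [hg] using c.map_notMem_B i)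
  refine ⟨c', ext_map_B hg ?_⟩
  change Coface.map a '' (Coface.map a ⁻¹' Coface.B c) ∪ Coface.B a = Coface.B c
  refine Set.Subset.antisymm (Set.union_subset (Set.image_preimage_subset _ _) hB) fun k hk => ?_
  by_cases hka : k ∈ Coface.B a
  · exact Or.inr hka
  · have hkA : k ∉ Coface.A a := fun h => Set.disjoint_left.1 c.disjoint (hA h) hk
    obtain ⟨j, rfl⟩ := (a.mem_range_map_iff k).2 ⟨hkA, hka⟩
    exact Or.inl ⟨j, hk, rfl⟩

instance (a : U ⟶ V) : Mono a where
  right_cancellation {W} c c' h := by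
    refine ext_map_B (fun i => (Coface.map a).injective ?_) ?_
    · rw [← comp_map, ← comp_map, h]
    · have hB := congrArg Coface.B h
      rw [comp_B, comp_B] at hB
      ext k
      simpa [a.map_notMem_B k] using Set.ext_iff.1 hB (Coface.map a k)

theorem exists_eq_eqToHom {c : U ⟶ V} (hA : Coface.A c = ∅) (hB : Coface.B c = ∅) :
    ∃ h : U = V, c = eqToHom h := by
  have hsurj : Function.Surjective (Coface.map c) := fun k =>
    (c.mem_range_map_iff k).2 ⟨by simp [hA], by simp [hB]⟩
  have hcard : U.size = V.size := by
    simpa using Fintype.card_congr (Equiv.ofBijective _ ⟨(Coface.map c).injective, hsurj⟩)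
  obtain ⟨n, l⟩ := U
  obtain ⟨m, l'⟩ := V
  obtain rfl : n = m := hcard
  have hid : ∀ i, Coface.map c i = i := by
    have : (RelIso.ofSurjective (Coface.map c) hsurj : Fin n ≃o Fin n) = OrderIso.refl _ :=
      Subsingleton.elim _ _
    exact fun i => DFunLike.congr_fun this i
  obtain rfl : l = l' := funext fun i => by
    have := c.label_map i
    rwa [hid, eq_comm] at this
  exact ⟨rfl, ext_map_B hid hB⟩

theorem eq_empty_of_image_map_union {s : Set (Fin U.size)} {t : Set (Fin V.size)} (d : Coface U V)
    (ht : ∀ i, d.map i ∉ t) (h : d.map '' s ∪ t = t) : s = ∅ :=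
  Set.eq_empty_of_forall_notMem fun i hi => ht i (h ▸ Or.inl ⟨i, hi, rfl⟩)

theorem sigma_ext {d : U ⟶ V} {d' : U' ⟶ V} (hA : Coface.A d = Coface.A d')
    (hB : Coface.B d = Coface.B d') :
    (⟨U, d⟩ : Σ U : LoSet α, U ⟶ V) = ⟨U', d'⟩ := by
  obtain ⟨c, rfl⟩ := exists_comp_eq_of_subset d d' hA.ge hB.ge
  obtain ⟨rfl, rfl⟩ := exists_eq_eqToHom (c := c)
    (eq_empty_of_image_map_union d' d'.map_notMem_A hA)
    (eq_empty_of_image_map_union d' d'.map_notMem_B hB)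
  simp

end Coface

instance LoSet.finite_cofaces (V : LoSet α) : Finite (Σ U : LoSet α, U ⟶ V) :=
  Finite.of_injective (fun d => (Coface.A d.2, Coface.B d.2)) fun ⟨_, _⟩ ⟨_, _⟩ h =>
    Coface.sigma_ext (congrArg Prod.fst h) (congrArg Prod.snd h)

/-! ### Words and alignment -/

/-- Composable sequences of starting and terminating coface maps: the part of a path that
determines its ipomset. -/
inductive StepWord (α : Type u) : LoSet α → LoSet α → Type u
  | nil (U : LoSet α) : StepWord α U U
  | up {U V W : LoSet α} (a : U ⟶ V) (ha : Coface.B a = ∅) (w : StepWord α V W) :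
      StepWord α U W
  | down {U V W : LoSet α} (b : V ⟶ U) (hb : Coface.A b = ∅) (w : StepWord α V W) :
      StepWord α U W

namespace StepWord

/-- Concatenation of step words. -/
def append : {U V W : LoSet α} → StepWord α U V → StepWord α V W → StepWord α U W
  | _, _, _, nil _, v => v
  | _, _, _, up a ha w, v => up a ha (w.append v)
  | _, _, _, down b hb w, v => down b hb (w.append v)

/-- `Align w v d`: the word `w` is obtained from `v` by delaying the start and advancing the
termination of events; this is subsumption, read off step by step. The coface map `d` relates the
currently active events: its `A` consists of the events active in `v` whose start is delayed in `w`,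
its `B` of those already terminated in `w`. -/
inductive Align : {U W V W' : LoSet α} → StepWord α U W → StepWord α V W' → (U ⟶ V) → Prop
  | nil (U : LoSet α) : Align (nil U) (nil U) (𝟙 U)
  | startRight {U W V V₁ W' : LoSet α} {w : StepWord α U W} {d : U ⟶ V} (a : V ⟶ V₁)
      (ha : Coface.B a = ∅) {v : StepWord α V₁ W'} (h : Align w v (d ≫ a)) : Align w (up a ha v) d
  | endRight {U W V V₁ W' : LoSet α} {w : StepWord α U W} {d : U ⟶ V₁} (b : V₁ ⟶ V)
      (hb : Coface.A b = ∅) {v : StepWord α V₁ W'} (h : Align w v d) :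
      Align w (down b hb v) (d ≫ b)
  | startLeft {U U₁ W V W' : LoSet α} (a : U ⟶ U₁) (ha : Coface.B a = ∅) {w : StepWord α U₁ W}
      {v : StepWord α V W'} {d : U₁ ⟶ V} (h : Align w v d) : Align (up a ha w) v (a ≫ d)
  | endLeft {U U₁ W V W' : LoSet α} (b : U₁ ⟶ U) (hb : Coface.A b = ∅) {w : StepWord α U₁ W}
      {v : StepWord α V W'} {d : U ⟶ V} (h : Align w v (b ≫ d)) : Align (down b hb w) v d

end StepWord

/-- `Accepts X acc w x`: there is a path over the word `w` from `x` to a cell in `acc`. -/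
def Accepts (X : PrecubicalSet α) (acc : Set (Cell X)) :
    {U W : LoSet α} → StepWord α U W → X.obj (op U) → Prop
  | U, _, .nil _, x => (⟨U, x⟩ : Cell X) ∈ acc
  | _, _, .up (V := V) a _ w, x => ∃ y : X.obj (op V), X.map a.op y = x ∧ Accepts X acc w y
  | _, _, .down b _ w, x => Accepts X acc w (X.map b.op x)

/-- The word of a path. -/
def HPath.word {X : PrecubicalSet α} {x y : Cell X} : HPath X x y → StepWord α x.1 y.1
  | .nil x => .nil x.1
  | .cons (.up _ _ d hd _) p => .up d hd p.word
  | .cons (.down _ _ d hd _) p => .down d hd p.word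

namespace Accepts

variable {X : PrecubicalSet α} {acc : Set (Cell X)} {U V W W' : LoSet α}

theorem of_align {w : StepWord α U W} {v : StepWord α V W'} {d : U ⟶ V}
    (h : StepWord.Align w v d) : ∀ x, Accepts X acc v x → Accepts X acc w (X.map d.op x) := by
  induction h with
  | nil U => exact fun x hx => by simpa using hx
  | startRight a ha _ ih =>
    rintro _ ⟨y, rfl, hy⟩
    simpa using ih y hy
  | endRight b hb _ ih => exact fun x hx => by simpa using ih _ hx
  | startLeft a _ _ ih => exact fun x hx => ⟨_, by simp, ih x hx⟩
  | endLeft b hb _ ih => exact fun x hx => by simpa [Accepts] using ih x hx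

theorem of_path {x y : Cell X} (p : HPath X x y) (hy : y ∈ acc) : Accepts X acc p.word x.2 := by
  induction p with
  | nil x => exact hy
  | cons s p ih =>
    cases s with
    | up x y d hd h => exact ⟨y, h, ih hy⟩
    | down x y d hd h => subst h; exact ih hy

theorem exists_path (w : StepWord α U W) :
    ∀ x, Accepts X acc w x → ∃ y : X.obj (op W), (⟨W, y⟩ : Cell X) ∈ acc ∧
      ∃ p : HPath X ⟨U, x⟩ ⟨W, y⟩, p.word = w := by
  induction w with
  | nil U => exact fun x hx => ⟨x, hx, .nil _, rfl⟩
  | up a ha w ih =>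
    rintro x ⟨y, h, hy⟩
    obtain ⟨z, hz, p, rfl⟩ := ih y hy
    exact ⟨z, hz, .cons (.up x y a ha h) p, rfl⟩
  | down b hb w ih =>
    intro x hx
    obtain ⟨z, hz, p, rfl⟩ := ih _ hx
    exact ⟨z, hz, .cons (.down x _ b hb rfl) p, rfl⟩

end Accepts

/-! ### Virtual cells and silent moves -/

/-- A virtual cell over `U` is a cell of `X` over some lo-set `base` together with a coface map
`U ⟶ base`: it stands for a run that is at `cell`, except that the start of the events in `A` of
the coface map is delayed and those in `B` are terminated ahead of time. -/
structure VirtualCell (X : PrecubicalSet α) (U : LoSet α) where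
  base : LoSet α
  cell : X.obj (op base)
  coface : U ⟶ base

namespace VirtualCell

variable {X : PrecubicalSet α} {U V W : LoSet α}

/-- The faces of a virtual cell. They only change the coface map, not the underlying cell. -/
def face (e : V ⟶ U) (c : VirtualCell X U) : VirtualCell X V := ⟨c.base, c.cell, e ≫ c.coface⟩

@[simp] theorem face_mk (e : V ⟶ U) (x : X.obj (op W)) (d : U ⟶ W) :
    face e (⟨W, x, d⟩ : VirtualCell X U) = ⟨W, x, e ≫ d⟩ := rfl

@[simp] theorem face_id (c : VirtualCell X U) : c.face (𝟙 U) = c := by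
  simp [face]

@[simp] theorem face_face (e : W ⟶ V) (e' : V ⟶ U) (c : VirtualCell X U) :
    (c.face e').face e = c.face (e ≫ e') := by
  simp [face]

end VirtualCell

/-- The silent moves between virtual cells: passing from an accept cell to a start cell, and
starting or terminating events in the underlying cell only. -/
inductive SilentStep (X : HDA α) : {U : LoSet α} → VirtualCell X.cells U →
    VirtualCell X.cells U → Prop
  | jump {U V : LoSet α} {x y : X.cells.obj (op V)} (d : U ⟶ V) (hx : ⟨V, x⟩ ∈ X.accept)
      (hy : ⟨V, y⟩ ∈ X.start) : SilentStep X ⟨V, x, d⟩ ⟨V, y, d⟩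
  | start {U V V₁ : LoSet α} (a : V ⟶ V₁) (ha : Coface.B a = ∅) (y : X.cells.obj (op V₁))
      (d : U ⟶ V) : SilentStep X ⟨V, X.cells.map a.op y, d⟩ ⟨V₁, y, d ≫ a⟩
  | finish {U V V₁ : LoSet α} (b : V₁ ⟶ V) (hb : Coface.A b = ∅) (x : X.cells.obj (op V))
      (d : U ⟶ V₁) : SilentStep X ⟨V, x, d ≫ b⟩ ⟨V₁, X.cells.map b.op x, d⟩

/-- Sequences of silent moves. -/
abbrev Silent (X : HDA α) {U : LoSet α} (c c' : VirtualCell X.cells U) : Prop :=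
  Relation.ReflTransGen (SilentStep X) c c'

section Silent

variable {X : HDA α} {U V : LoSet α}

theorem SilentStep.face (e : V ⟶ U) {c c' : VirtualCell X.cells U} (h : SilentStep X c c') :
    SilentStep X (c.face e) (c'.face e) := by
  cases h with
  | jump d hx hy => exact .jump _ hx hy
  | start a ha y d =>
    rw [VirtualCell.face_mk, VirtualCell.face_mk, ← Category.assoc]
    exact .start a ha y _
  | finish b hb x d =>
    rw [VirtualCell.face_mk, VirtualCell.face_mk, ← Category.assoc]
    exact .finish b hb x _

theorem Silent.face (e : V ⟶ U) {c c' : VirtualCell X.cells U} (h : Silent X c c') :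
    Silent X (c.face e) (c'.face e) :=
  Relation.ReflTransGen.lift (VirtualCell.face e) (fun _ _ => SilentStep.face e) _ _ h

end Silent

/-- A virtual cell is accepting if silent moves lead from it to an accept cell of `X` in which
no event is delayed or terminated ahead of time. -/
def IsAccepting (X : HDA α) {U : LoSet α} (c : VirtualCell X.cells U) : Prop :=
  ∃ x : X.cells.obj (op U), (⟨U, x⟩ : Cell X.cells) ∈ X.accept ∧ Silent X c ⟨U, x, 𝟙 U⟩

/-- Acceptance of step words by virtual cells. The letters of the word only act on the coface map;
the underlying cell changes by silent moves. -/
def VirtuallyAccepts (X : HDA α) : {U W : LoSet α} → StepWord α U W → VirtualCell X.cells U → Prop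
  | _, _, .nil _, c => IsAccepting X c
  | _, _, .up (V := V) a _ w, c =>
    ∃ c' : VirtualCell X.cells V, Silent X c (c'.face a) ∧ VirtuallyAccepts X w c'
  | _, _, .down b _ w, c => VirtuallyAccepts X w (c.face b)

theorem VirtuallyAccepts.of_silent {X : HDA α} {U W : LoSet α} (w : StepWord α U W) :
    ∀ {c c' : VirtualCell X.cells U}, Silent X c c' →
      VirtuallyAccepts X w c' → VirtuallyAccepts X w c := by
  induction w with
  | nil U => exact fun h ⟨x, hx, h'⟩ => ⟨x, hx, h.trans h'⟩
  | up a ha w _ => exact fun h ⟨c'', h', hc⟩ => ⟨c'', h.trans h', hc⟩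
  | down b hb w ih => exact fun h h' => ih (h.face b) h'

/-! ### Lax cells -/

/-- A lax cell over `U`: a virtual cell over every face of `U`, compatibly with upper faces, but
with lower faces only up to silent moves. These are the cells of the automaton for the Kleene plus;
the silent moves of that automaton hide in the laxness. -/
structure LaxCell (X : HDA α) (U : LoSet α) where
  toFun : ∀ W : LoSet α, (W ⟶ U) → VirtualCell X.cells W
  strict : ∀ {W W' : LoSet α} (e : W' ⟶ W) (c : W ⟶ U), Coface.A e = ∅ →
    toFun _ (e ≫ c) = (toFun _ c).face e
  lax : ∀ {W W' : LoSet α} (e : W' ⟶ W) (c : W ⟶ U),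
    Silent X (toFun _ (e ≫ c)) ((toFun _ c).face e)

namespace LaxCell

variable {X : HDA α} {U V W : LoSet α}

theorem ext {F G : LaxCell X U} (h : ∀ W c, F.toFun W c = G.toFun W c) : F = G := by
  cases F
  cases G
  congr
  funext W c
  exact h W c

/-- The virtual cell that a lax cell has over `U` itself. -/
def top (F : LaxCell X U) : VirtualCell X.cells U := F.toFun U (𝟙 U)

/-- The faces of a lax cell, by restriction. -/
def face (e : V ⟶ U) (F : LaxCell X U) : LaxCell X V where
  toFun W c := F.toFun W (c ≫ e)
  strict e' c h := by rw [Category.assoc, F.strict _ _ h]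
  lax e' c := by rw [Category.assoc]; exact F.lax _ _

@[simp] theorem face_id (F : LaxCell X U) : F.face (𝟙 U) = F :=
  ext fun _ _ => by simp [face]

theorem face_comp (e : W ⟶ V) (e' : V ⟶ U) (F : LaxCell X U) :
    F.face (e ≫ e') = (F.face e').face e :=
  ext fun _ _ => by simp [face]

theorem toFun_silent (F : LaxCell X U) (e : V ⟶ U) : Silent X (F.toFun V e) (F.top.face e) := by
  have h := F.lax e (𝟙 U)
  rwa [Category.comp_id] at h

theorem face_top_silent (F : LaxCell X U) (e : V ⟶ U) :
    Silent X (F.face e).top (F.top.face e) := by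
  simpa [top, face] using F.toFun_silent e

theorem face_top_of_A_eq_empty (F : LaxCell X U) (e : V ⟶ U) (he : Coface.A e = ∅) :
    (F.face e).top = F.top.face e := by
  simpa [top, face] using F.strict e (𝟙 U) he

/-- The lax cell of all faces of a virtual cell. -/
def ofVirtualCell (c : VirtualCell X.cells U) : LaxCell X U where
  toFun _ e := c.face e
  strict _ _ _ := by simp
  lax _ _ := by rw [VirtualCell.face_face]

@[simp] theorem ofVirtualCell_top (c : VirtualCell X.cells U) : (ofVirtualCell c).top = c := by
  simp [ofVirtualCell, top]

section Extend

variable (F : LaxCell X U) (a : U ⟶ V) (c : VirtualCell X.cells V)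

open Classical in
/-- The family of virtual cells that agrees with the lax cell `F` on the faces of `U`, seen in `V`
through `a`, and with the faces of `c` elsewhere. -/
noncomputable def extendFun (W : LoSet α) (e : W ⟶ V) : VirtualCell X.cells W :=
  if h : ∃ e', e' ≫ a = e then F.toFun W h.choose else c.face e

variable {F a c}

theorem extendFun_comp (e : W ⟶ U) : F.extendFun a c W (e ≫ a) = F.toFun W e := by
  have h : ∃ e', e' ≫ a = e ≫ a := ⟨e, rfl⟩
  rw [extendFun, dif_pos h, (cancel_mono a).1 h.choose_spec]

theorem extendFun_of_not_factors {e : W ⟶ V} (h : ¬ ∃ e', e' ≫ a = e) :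
    F.extendFun a c W e = c.face e :=
  dif_neg h

theorem extendFun_silent (h : Silent X F.top (c.face a)) (e : W ⟶ V) :
    Silent X (F.extendFun a c W e) (c.face e) := by
  by_cases he : ∃ e', e' ≫ a = e
  · obtain ⟨e', rfl⟩ := he
    rw [extendFun_comp, ← VirtualCell.face_face]
    exact (F.toFun_silent e').trans (h.face e')
  · rw [extendFun_of_not_factors he]

/-- The extension of a lax cell on a lower face to a lax cell with top `c`, up to silent moves. -/
noncomputable def extend (F : LaxCell X U) (a : U ⟶ V) (ha : Coface.B a = ∅)
    (c : VirtualCell X.cells V) (h : Silent X F.top (c.face a)) : LaxCell X V where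
  toFun := F.extendFun a c
  strict {W W'} e e' he := by
    by_cases h' : ∃ k, k ≫ a = e'
    · obtain ⟨k, rfl⟩ := h'
      rw [← Category.assoc, extendFun_comp, extendFun_comp, F.strict _ _ he]
    · rw [extendFun_of_not_factors h', extendFun_of_not_factors, VirtualCell.face_face]
      rintro ⟨k, hk⟩
      -- `e` misses no unstarted events, so those of `a` are already missed by `e'`
      have hA : Coface.A a ⊆ Coface.A e' := by
        have := congrArg Coface.A hk
        rw [Coface.comp_A, Coface.comp_A, he, Set.image_empty, Set.empty_union] at this
        exact this ▸ Set.subset_union_right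
      exact h' (Coface.exists_comp_eq_of_subset e' a hA (by simp [ha]))
  lax {W W'} e e' := by
    by_cases h' : ∃ k, k ≫ a = e'
    · obtain ⟨k, rfl⟩ := h'
      rw [← Category.assoc, extendFun_comp, extendFun_comp]
      exact F.lax _ _
    · rw [extendFun_of_not_factors h', VirtualCell.face_face]
      exact extendFun_silent h _

variable (ha : Coface.B a = ∅) (h : Silent X F.top (c.face a))

theorem extend_face : (F.extend a ha c h).face a = F :=
  ext fun _ e => extendFun_comp e

theorem extend_top_silent : Silent X (F.extend a ha c h).top c := by
  have h' := extendFun_silent h (𝟙 V)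
  rwa [VirtualCell.face_id] at h'

end Extend

end LaxCell

section LaxCells

variable (X : HDA α)

instance : Finite (Σ U : LoSet α, VirtualCell X.cells U) := by
  have := X.finite
  let F : (Σ c : Cell X.cells, Σ U : LoSet α, U ⟶ c.1) → Σ U : LoSet α, VirtualCell X.cells U :=
    fun x => ⟨x.2.1, x.1.1, x.1.2, x.2.2⟩
  exact Finite.of_surjective F fun ⟨U, V, x, d⟩ => ⟨⟨⟨V, x⟩, U, d⟩, rfl⟩

instance (U : LoSet α) : Finite (VirtualCell X.cells U) :=
  Finite.of_injective (fun c => (⟨U, c⟩ : Σ U : LoSet α, VirtualCell X.cells U))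
    sigma_mk_injective

instance (U : LoSet α) : Finite (LaxCell X U) :=
  Finite.of_injective
    (fun (F : LaxCell X U) (e : Σ W : LoSet α, W ⟶ U) => F.toFun e.1 e.2)
    fun _ _ h => LaxCell.ext fun W e => congrFun h ⟨W, e⟩

/-- The precubical set of lax cells. As these live in `Type u` while precubical sets are valued in
`Type`, the finite sets of lax cells are shrunk. -/
noncomputable def laxCells : PrecubicalSet α where
  obj U := Shrink.{0} (LaxCell X U.unop)
  map e := TypeCat.ofHom fun F => equivShrink _ (((equivShrink _).symm F).face e.unop)
  map_id U := by
    refine ConcreteCategory.hom_ext _ _ fun F => ?_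
    simp
  map_comp e e' := by
    refine ConcreteCategory.hom_ext _ _ fun F => ?_
    simp [LaxCell.face_comp]

/-- The lax cell underlying a cell of `laxCells`. -/
noncomputable def laxCellEquiv (U : LoSet α) : (laxCells X).obj (op U) ≃ LaxCell X U :=
  (equivShrink _).symm

theorem laxCellEquiv_map {U V : LoSet α} (e : U ⟶ V) (x : (laxCells X).obj (op V)) :
    laxCellEquiv X U ((laxCells X).map e.op x) = (laxCellEquiv X V x).face e :=
  (equivShrink _).symm_apply_apply _

theorem finite_cell_laxCells : Finite (Cell (laxCells X)) := by
  let I := {U : LoSet α // Nonempty (VirtualCell X.cells U)}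
  have : Finite I := Finite.of_surjective
    (fun x : Σ U : LoSet α, VirtualCell X.cells U => (⟨x.1, ⟨x.2⟩⟩ : I))
    fun ⟨U, ⟨x⟩⟩ => ⟨⟨U, x⟩, rfl⟩
  refine Finite.of_surjective
    (fun x : Σ U : I, LaxCell X U.1 => (⟨x.1.1, (laxCellEquiv X _).symm x.2⟩ : Cell _)) ?_
  rintro ⟨U, x⟩
  exact ⟨⟨⟨U, ⟨(laxCellEquiv X U x).top⟩⟩, laxCellEquiv X U x⟩, by simp⟩

/-- The lax cells whose top is a start cell of `X`. -/
def laxStart : Set (Cell (laxCells X)) :=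
  {c | ∃ x, (⟨c.1, x⟩ : Cell X.cells) ∈ X.start ∧ (laxCellEquiv X _ c.2).top = ⟨c.1, x, 𝟙 _⟩}

/-- The lax cells from whose top silent moves lead to an accept cell of `X`. -/
def laxAccept : Set (Cell (laxCells X)) :=
  {c | IsAccepting X (laxCellEquiv X _ c.2).top}

/-- The automaton recognising the Kleene plus of the language of `X`. -/
noncomputable def HDA.plus : HDA α where
  cells := laxCells X
  finite := finite_cell_laxCells X
  start := laxStart X
  accept := laxAccept X

end LaxCells

/-! ### The words accepted by the automaton of lax cells -/

section Acceptance

variable {X : HDA α} {U V W : LoSet α}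

theorem VirtuallyAccepts.of_accepts_laxCells (w : StepWord α U W) :
    ∀ x, Accepts (laxCells X) (laxAccept X) w x →
      VirtuallyAccepts X w (laxCellEquiv X U x).top := by
  induction w with
  | nil U => exact fun x hx => hx
  | up a ha w ih =>
    rintro _ ⟨y, rfl, hy⟩
    refine ⟨_, ?_, ih y hy⟩
    rw [laxCellEquiv_map]
    exact LaxCell.face_top_silent _ _
  | down b hb w ih =>
    intro x hx
    have := ih _ hx
    rwa [laxCellEquiv_map, LaxCell.face_top_of_A_eq_empty _ _ hb] at this

theorem VirtuallyAccepts.accepts_laxCells (w : StepWord α U W) :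
    ∀ c, VirtuallyAccepts X w c → ∀ x, Silent X (laxCellEquiv X U x).top c →
      Accepts (laxCells X) (laxAccept X) w x := by
  induction w with
  | nil U => exact fun c ⟨y, hy, hc⟩ x hx => ⟨y, hy, hx.trans hc⟩
  | up a ha w ih =>
    rintro c ⟨c', hc, hc'⟩ x hx
    have h := hx.trans hc
    refine ⟨(laxCellEquiv X _).symm (LaxCell.extend _ a ha c' h), (laxCellEquiv X _).injective ?_,
      ih c' hc' _ ?_⟩
    · rw [laxCellEquiv_map, Equiv.apply_symm_apply, LaxCell.extend_face]
    · rw [Equiv.apply_symm_apply]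
      exact LaxCell.extend_top_silent ha h
  | down b hb w ih =>
    intro c hc x hx
    refine ih _ hc _ ?_
    rw [laxCellEquiv_map, LaxCell.face_top_of_A_eq_empty _ _ hb]
    exact hx.face b

/-- Passing from an accept cell to a start cell over the same lo-set. -/
def Jump (X : HDA α) {U : LoSet α} (x y : X.cells.obj (op U)) : Prop :=
  (⟨U, x⟩ : Cell X.cells) ∈ X.accept ∧ (⟨U, y⟩ : Cell X.cells) ∈ X.start

theorem Silent.of_jumps {x y : X.cells.obj (op V)} (h : Relation.ReflTransGen (Jump X) x y)
    (d : U ⟶ V) : Silent X ⟨V, x, d⟩ ⟨V, y, d⟩ :=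
  Relation.ReflTransGen.lift (fun x => (⟨V, x, d⟩ : VirtualCell X.cells U))
    (fun _ _ h => .jump d h.1 h.2) _ _ h

/-- `JumpAccepts X w x`: some path over `w`, interspersed with jumps, leads from `x` to an accept
cell. -/
def JumpAccepts (X : HDA α) : {U W : LoSet α} → StepWord α U W → X.cells.obj (op U) → Prop
  | U, _, .nil _, x =>
    ∃ y : X.cells.obj (op U), Relation.ReflTransGen (Jump X) x y ∧
      (⟨U, y⟩ : Cell X.cells) ∈ X.accept
  | _, _, .up (V := V) a _ w, x => ∃ y : X.cells.obj (op V),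
    Relation.ReflTransGen (Jump X) x (X.cells.map a.op y) ∧ JumpAccepts X w y
  | U, _, .down b _ w, x => ∃ y : X.cells.obj (op U),
    Relation.ReflTransGen (Jump X) x y ∧ JumpAccepts X w (X.cells.map b.op y)

theorem JumpAccepts.of_jumps {w : StepWord α U W} {x y : X.cells.obj (op U)}
    (h : Relation.ReflTransGen (Jump X) x y) (hy : JumpAccepts X w y) : JumpAccepts X w x := by
  cases w with
  | nil U => exact hy.imp fun _ hz => ⟨h.trans hz.1, hz.2⟩
  | up a ha w => exact hy.imp fun _ hz => ⟨h.trans hz.1, hz.2⟩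
  | down b hb w => exact hy.imp fun _ hz => ⟨h.trans hz.1, hz.2⟩

/-- The word `w` is aligned, along the coface map of the virtual cell `c`, with a word that is
accepted with jumps from the underlying cell. -/
def AlignAccepts (X : HDA α) (w : StepWord α U W) (c : VirtualCell X.cells U) : Prop :=
  ∃ (V : LoSet α) (v : StepWord α c.base V), JumpAccepts X v c.cell ∧ StepWord.Align w v c.coface

theorem AlignAccepts.of_silent {w : StepWord α U W} {c c' : VirtualCell X.cells U}
    (h : Silent X c c') (hc : AlignAccepts X w c') : AlignAccepts X w c := by
  induction h using Relation.ReflTransGen.head_induction_on with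
  | refl => exact hc
  | head h _ ih =>
    obtain ⟨V, v, hv, hw⟩ := ih
    cases h with
    | jump d hx hy => exact ⟨V, v, hv.of_jumps (.single ⟨hx, hy⟩), hw⟩
    | start a ha y d => exact ⟨V, .up a ha v, ⟨y, .refl, hv⟩, .startRight a ha hw⟩
    | finish b hb x d => exact ⟨V, .down b hb v, ⟨x, .refl, hv⟩, .endRight b hb hw⟩

theorem VirtuallyAccepts.alignAccepts (w : StepWord α U W) :
    ∀ c, VirtuallyAccepts X w c → AlignAccepts X w c := by
  induction w with
  | nil U =>
    rintro c ⟨x, hx, hc⟩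
    exact AlignAccepts.of_silent hc ⟨U, .nil U, ⟨x, .refl, hx⟩, .nil U⟩
  | up a ha w ih =>
    rintro c ⟨c', hc, hc'⟩
    obtain ⟨V, v, hv, hw⟩ := ih c' hc'
    exact AlignAccepts.of_silent hc ⟨V, v, hv, .startLeft a ha hw⟩
  | down b hb w ih =>
    intro c hc
    obtain ⟨V, v, hv, hw⟩ := ih _ hc
    exact ⟨V, v, hv, .endLeft b hb hw⟩

theorem VirtuallyAccepts.of_align {W' : LoSet α} {w : StepWord α U W} {v : StepWord α V W'}
    {d : U ⟶ V} (h : StepWord.Align w v d) :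
    ∀ x : X.cells.obj (op V), JumpAccepts X v x → VirtuallyAccepts X w ⟨V, x, d⟩ := by
  induction h with
  | nil U => exact fun x ⟨y, hxy, hy⟩ => ⟨y, hy, .of_jumps hxy _⟩
  | startRight a ha _ ih =>
    rintro x ⟨y, hxy, hy⟩
    exact .of_silent _ ((Silent.of_jumps hxy _).tail (.start a ha y _)) (ih y hy)
  | endRight b hb _ ih =>
    rintro x ⟨y, hxy, hy⟩
    exact .of_silent _ ((Silent.of_jumps hxy _).tail (.finish b hb y _)) (ih _ hy)
  | startLeft a _ _ ih => exact fun x hx => ⟨_, .refl, ih x hx⟩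
  | endLeft _ _ _ ih => exact fun x hx => ih x hx

/-- `PowAccepts X n w x`: the word `w` is a concatenation of the words of `n + 1` paths to accept
cells, the first of them from `x` and the others from start cells. -/
def PowAccepts (X : HDA α) : ℕ → {U W : LoSet α} → StepWord α U W → X.cells.obj (op U) → Prop
  | 0, _, _, w, x => Accepts X.cells X.accept w x
  | n + 1, U, W, w, x => ∃ (V : LoSet α) (w₀ : StepWord α U V) (w₁ : StepWord α V W)
    (y : X.cells.obj (op V)), w₀.append w₁ = w ∧ Accepts X.cells X.accept w₀ x ∧
      (⟨V, y⟩ : Cell X.cells) ∈ X.start ∧ PowAccepts X n w₁ y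

theorem Accepts.jumpAccepts (w : StepWord α U W) :
    ∀ x, Accepts X.cells X.accept w x → JumpAccepts X w x := by
  induction w with
  | nil U => exact fun x hx => ⟨x, .refl, hx⟩
  | up a ha w ih => rintro _ ⟨y, rfl, hy⟩; exact ⟨y, .refl, ih y hy⟩
  | down b hb w ih => exact fun x hx => ⟨x, .refl, ih _ hx⟩

theorem JumpAccepts.append (w₀ : StepWord α U V) (w₁ : StepWord α V W)
    {y : X.cells.obj (op V)} (hy : (⟨V, y⟩ : Cell X.cells) ∈ X.start) (h : JumpAccepts X w₁ y) :
    ∀ x, Accepts X.cells X.accept w₀ x → JumpAccepts X (w₀.append w₁) x := by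
  induction w₀ with
  | nil U => exact fun x hx => h.of_jumps (.single ⟨hx, hy⟩)
  | up a ha w ih => rintro _ ⟨z, rfl, hz⟩; exact ⟨z, .refl, ih w₁ hy h z hz⟩
  | down b hb w ih => exact fun x hx => ⟨x, .refl, ih w₁ hy h _ hx⟩

namespace PowAccepts

theorem jumpAccepts (n : ℕ) : ∀ {U W : LoSet α} (w : StepWord α U W) (x : X.cells.obj (op U)),
    PowAccepts X n w x → JumpAccepts X w x := by
  induction n with
  | zero => exact fun w x h => Accepts.jumpAccepts w x h
  | succ n ih =>
    rintro U W _ x ⟨V, w₀, w₁, y, rfl, hx, hy, h⟩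
    exact JumpAccepts.append w₀ w₁ hy (ih w₁ y h) x hx

theorem up {n : ℕ} {a : U ⟶ V} {ha : Coface.B a = ∅} {w : StepWord α V W}
    {y : X.cells.obj (op V)} (h : PowAccepts X n w y) :
    PowAccepts X n (.up a ha w) (X.cells.map a.op y) := by
  cases n with
  | zero => exact ⟨y, rfl, h⟩
  | succ n =>
    obtain ⟨V', w₀, w₁, z, rfl, h₀, hz, h₁⟩ := h
    exact ⟨V', .up a ha w₀, w₁, z, rfl, ⟨y, rfl, h₀⟩, hz, h₁⟩

theorem down {n : ℕ} {b : V ⟶ U} {hb : Coface.A b = ∅} {w : StepWord α V W}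
    {x : X.cells.obj (op U)} (h : PowAccepts X n w (X.cells.map b.op x)) :
    PowAccepts X n (.down b hb w) x := by
  cases n with
  | zero => exact h
  | succ n =>
    obtain ⟨V', w₀, w₁, z, rfl, h₀, hz, h₁⟩ := h
    exact ⟨V', .down b hb w₀, w₁, z, rfl, h₀, hz, h₁⟩

theorem exists_of_jumps {w : StepWord α U W} {x y : X.cells.obj (op U)}
    (h : Relation.ReflTransGen (Jump X) x y) (hy : ∃ n, PowAccepts X n w y) :
    ∃ n, PowAccepts X n w x := by
  induction h using Relation.ReflTransGen.head_induction_on with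
  | refl => exact hy
  | head h _ ih =>
    obtain ⟨n, hn⟩ := ih
    exact ⟨n + 1, U, .nil U, w, _, rfl, h.1, h.2, hn⟩

end PowAccepts

theorem JumpAccepts.exists_powAccepts (w : StepWord α U W) :
    ∀ x : X.cells.obj (op U), JumpAccepts X w x → ∃ n, PowAccepts X n w x := by
  induction w with
  | nil U => exact fun x ⟨y, hxy, hy⟩ => PowAccepts.exists_of_jumps hxy ⟨0, hy⟩
  | up a ha w ih =>
    rintro x ⟨y, hxy, hy⟩
    exact PowAccepts.exists_of_jumps hxy ((ih y hy).imp fun _ => .up)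
  | down b hb w ih =>
    rintro x ⟨y, hxy, hy⟩
    exact PowAccepts.exists_of_jumps hxy ((ih _ hy).imp fun _ => .down)

theorem exists_accepts_laxCells_iff (w : StepWord α U W) :
    (∃ x, (⟨U, x⟩ : Cell (laxCells X)) ∈ laxStart X ∧ Accepts (laxCells X) (laxAccept X) w x) ↔
      ∃ (x : X.cells.obj (op U)) (V : LoSet α) (v : StepWord α U V) (n : ℕ),
        (⟨U, x⟩ : Cell X.cells) ∈ X.start ∧ PowAccepts X n v x ∧ StepWord.Align w v (𝟙 U) := by
  constructor
  · rintro ⟨c, ⟨x, hx, hc⟩, hw⟩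
    obtain ⟨V, v, hv, hwv⟩ := (hc ▸ VirtuallyAccepts.of_accepts_laxCells w c hw).alignAccepts w _
    obtain ⟨n, hn⟩ := hv.exists_powAccepts v _
    exact ⟨x, V, v, n, hx, hn, hwv⟩
  · rintro ⟨x, V, v, n, hx, hv, hwv⟩
    let c := (laxCellEquiv X U).symm (.ofVirtualCell ⟨U, x, 𝟙 U⟩)
    have hc : (laxCellEquiv X U c).top = ⟨U, x, 𝟙 U⟩ := by simp [c]
    exact ⟨c, ⟨x, hx, hc⟩, (VirtuallyAccepts.of_align hwv x (hv.jumpAccepts n)).accepts_laxCells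
      w _ c (by rw [hc])⟩

end Acceptance

/-! ### Embeddings and gluings of iposets -/

namespace Iposet

section Concurrency

variable {P Q : Iposet α} {x y : P.carrier}

/-- Two events are concurrent if they are incomparable with respect to precedence. -/
def Conc (P : Iposet α) (x y : P.carrier) : Prop := ¬ P.prec x y ∧ ¬ P.prec y x

theorem prec_asymm (h : P.prec x y) : ¬ P.prec y x :=
  fun h' => P.prec_irrefl _ (P.prec_trans _ _ _ h h')

theorem event_asymm (h : P.event x y) : ¬ P.event y x :=
  fun h' => P.event_irrefl _ (P.event_trans _ _ _ h h')

theorem Conc.symm (h : P.Conc x y) : P.Conc y x := And.symm h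

theorem Conc.event_trichotomy (h : P.Conc x y) : x = y ∨ P.event x y ∨ P.event y x :=
  (P.comparable x y).imp_right fun h' => (h'.resolve_left h.1).resolve_left h.2

theorem conc_of_mem_S (hx : x ∈ P.S) (hy : y ∈ P.S) : P.Conc x y :=
  ⟨P.S_minimal y hy x, P.S_minimal x hx y⟩

theorem conc_of_mem_T (hx : x ∈ P.T) (hy : y ∈ P.T) : P.Conc x y :=
  ⟨P.T_maximal x hx y, P.T_maximal y hy x⟩

end Concurrency

/-- A lax embedding of iposets is a subsumption of `P` by the restriction of `Q` to the image of
`f`, interfaces being ignored. -/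
structure IsLaxEmbedding (P Q : Iposet α) (f : P.carrier → Q.carrier) : Prop where
  injective : Function.Injective f
  label : ∀ x, Q.label (f x) = P.label x
  prec : ∀ {x y}, Q.prec (f x) (f y) → P.prec x y
  event : ∀ {x y}, P.Conc x y → P.event x y → Q.event (f x) (f y)

/-- An embedding of iposets is a lax embedding that preserves precedence, that is, an isomorphism
onto its image, interfaces being ignored. -/
structure IsEmbedding (P Q : Iposet α) (f : P.carrier → Q.carrier) : Prop
    extends IsLaxEmbedding P Q f where
  map_prec : ∀ {x y}, P.prec x y → Q.prec (f x) (f y)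

section Embedding

variable {P Q R : Iposet α} {f : P.carrier → Q.carrier} {g : Q.carrier → R.carrier}

theorem IsSubsumption.isLaxEmbedding {f : P.carrier ≃ Q.carrier} (hf : IsSubsumption P Q f) :
    IsLaxEmbedding P Q f :=
  ⟨f.injective, hf.label, hf.prec _ _, fun hc h => hf.event _ _ h hc.1 hc.2⟩

theorem IsLaxEmbedding.conc (hf : IsLaxEmbedding P Q f) {x y : P.carrier} (h : P.Conc x y) :
    Q.Conc (f x) (f y) :=
  ⟨mt hf.prec h.1, mt hf.prec h.2⟩

theorem IsLaxEmbedding.event_iff (hf : IsLaxEmbedding P Q f) {x y : P.carrier}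
    (hc : P.Conc x y) : Q.event (f x) (f y) ↔ P.event x y := by
  refine ⟨fun h => ?_, hf.event hc⟩
  rcases hc.event_trichotomy with rfl | h' | h'
  · exact (Q.event_irrefl _ h).elim
  · exact h'
  · exact (event_asymm h (hf.event hc.symm h')).elim

theorem IsLaxEmbedding.comp (hg : IsLaxEmbedding Q R g) (hf : IsLaxEmbedding P Q f) :
    IsLaxEmbedding P R (g ∘ f) where
  injective := hg.injective.comp hf.injective
  label x := (hg.label _).trans (hf.label x)
  prec h := hf.prec (hg.prec h)
  event hc h := hg.event (hf.conc hc) (hf.event hc h)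

namespace IsEmbedding

theorem prec_iff (hf : IsEmbedding P Q f) {x y : P.carrier} : Q.prec (f x) (f y) ↔ P.prec x y :=
  ⟨hf.prec, hf.map_prec⟩

theorem conc_iff (hf : IsEmbedding P Q f) {x y : P.carrier} : Q.Conc (f x) (f y) ↔ P.Conc x y :=
  and_congr (not_congr hf.prec_iff) (not_congr hf.prec_iff)

protected theorem id (P : Iposet α) : IsEmbedding P P _root_.id :=
  ⟨⟨Function.injective_id, fun _ => rfl, _root_.id, fun _ => _root_.id⟩, _root_.id⟩

theorem comp (hg : IsEmbedding Q R g) (hf : IsEmbedding P Q f) : IsEmbedding P R (g ∘ f) :=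
  ⟨hg.toIsLaxEmbedding.comp hf.toIsLaxEmbedding, fun h => hg.map_prec (hf.map_prec h)⟩

theorem symm {e : P.carrier ≃ Q.carrier} (he : IsEmbedding P Q e) : IsEmbedding Q P e.symm where
  injective := e.symm.injective
  label y := by rw [← he.label, e.apply_symm_apply]
  prec h := by simpa only [e.apply_symm_apply] using he.map_prec h
  event {x y} hc h := by
    rw [← e.apply_symm_apply x, ← e.apply_symm_apply y] at hc h
    exact (he.event_iff (he.conc_iff.1 hc)).1 h
  map_prec h := he.prec (by simpa only [e.apply_symm_apply] using h)

end IsEmbedding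

theorem IsLaxEmbedding.of_comp (hg : IsEmbedding Q R g) (hgf : IsLaxEmbedding P R (g ∘ f)) :
    IsLaxEmbedding P Q f where
  injective := hgf.injective.of_comp
  label x := (hg.label _).symm.trans (hgf.label x)
  prec h := hgf.prec (hg.map_prec h)
  event hc h := (hg.event_iff (hg.conc_iff.1 (hgf.conc hc))).1 (hgf.event hc h)

end Embedding

namespace Marking

variable {U V : LoSet α} {P : Iposet α} {I : Set P.carrier}

/-- The events of a marked interface. -/
def emb (s : Marking U P I) (k : Fin U.size) : P.carrier := s.equiv k

theorem emb_mem (s : Marking U P I) (k : Fin U.size) : s.emb k ∈ I := (s.equiv k).2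

theorem exists_emb_eq (s : Marking U P I) {x : P.carrier} (hx : x ∈ I) : ∃ k, s.emb k = x :=
  ⟨s.equiv.symm ⟨x, hx⟩, by simp [emb]⟩

theorem range_emb (s : Marking U P I) : Set.range s.emb = I :=
  Set.Subset.antisymm (Set.range_subset_iff.2 s.emb_mem) fun _ => s.exists_emb_eq

theorem emb_injective (s : Marking U P I) : Function.Injective s.emb :=
  Subtype.val_injective.comp s.equiv.injective

theorem event_emb_iff (s : Marking U P I) {i j : Fin U.size} :
    P.event (s.emb i) (s.emb j) ↔ i < j := (s.event_iff i j).symm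

theorem label_emb (s : Marking U P I) (i : Fin U.size) : P.label (s.emb i) = U.label i :=
  s.label_eq i

theorem isEmbedding_emb (s : Marking U P P.S) (S T : Set (Fin U.size)) :
    IsEmbedding (discrete U S T) P s.emb where
  injective := s.emb_injective
  label := s.label_emb
  prec h := (P.S_minimal _ (s.emb_mem _) _ h).elim
  event _ h := s.event_emb_iff.2 h
  map_prec h := h.elim

/-- The marking transported along an embedding. -/
noncomputable def image {Q : Iposet α} {f : P.carrier → Q.carrier} (s : Marking U P I)
    (hf : IsEmbedding P Q f) (hI : ∀ x ∈ I, ∀ y ∈ I, P.Conc x y) : Marking U Q (f '' I) where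
  equiv := s.equiv.trans (Equiv.Set.image f I hf.injective)
  event_iff i j := (s.event_iff i j).trans
    (hf.event_iff (hI _ (s.emb_mem i) _ (s.emb_mem j))).symm
  label_eq i := (hf.label _).trans (s.label_eq i)

end Marking

theorem isLaxEmbedding_cofaceMap {U V : LoSet α} (d : U ⟶ V) (S T : Set (Fin U.size))
    (S' T' : Set (Fin V.size)) :
    IsLaxEmbedding (discrete U S T) (discrete V S' T') (Coface.map d) where
  injective := (Coface.map d).injective
  label := d.label_map
  prec := id
  event _ h := (Coface.map d).strictMono h

/-- `R` is the gluing of `P` and `Q` with structural inclusions `i` and `j`, up to isomorphism. -/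
structure IsGluing (P Q R : Iposet α) (i : P.carrier → R.carrier) (j : Q.carrier → R.carrier) :
    Prop where
  left : IsEmbedding P R i
  right : IsEmbedding Q R j
  image_T : i '' P.T = j '' Q.S
  inter : ∀ {x y}, i x = j y → x ∈ P.T
  cover : ∀ r, r ∈ Set.range i ∨ r ∈ Set.range j
  prec : ∀ {x y}, x ∉ P.T → y ∉ Q.S → R.prec (i x) (j y)
  src : i '' P.S = R.S
  tgt : j '' Q.T = R.T

namespace IsGluing

variable {P Q R : Iposet α} {i : P.carrier → R.carrier} {j : Q.carrier → R.carrier}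

theorem exists_right_eq (h : IsGluing P Q R i j) {x : P.carrier} (hx : x ∈ P.T) :
    ∃ y ∈ Q.S, j y = i x := by
  have hx' : i x ∈ i '' P.T := Set.mem_image_of_mem i hx
  rwa [h.image_T] at hx'

theorem exists_left_eq (h : IsGluing P Q R i j) {y : Q.carrier} (hy : y ∈ Q.S) :
    ∃ x ∈ P.T, i x = j y := by
  have hy' : j y ∈ j '' Q.S := Set.mem_image_of_mem j hy
  rwa [← h.image_T] at hy'

theorem mem_S_of_eq (h : IsGluing P Q R i j) {x : P.carrier} {y : Q.carrier} (hxy : i x = j y) :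
    y ∈ Q.S := by
  obtain ⟨y', hy', e⟩ := h.exists_right_eq (h.inter hxy)
  rwa [← h.right.injective (e.trans hxy)]

theorem cases_right (h : IsGluing P Q R i j) (r : R.carrier) :
    (∃ y, j y = r) ∨ ∃ x ∉ P.T, i x = r := by
  rcases h.cover r with ⟨x, rfl⟩ | hr
  · by_cases hx : x ∈ P.T
    · exact Or.inl ((h.exists_right_eq hx).imp fun _ => And.right)
    · exact Or.inr ⟨x, hx, rfl⟩
  · exact Or.inl hr

theorem cases_left (h : IsGluing P Q R i j) (r : R.carrier) :
    (∃ x, i x = r) ∨ ∃ y ∉ Q.S, j y = r := by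
  rcases h.cover r with hr | ⟨y, rfl⟩
  · exact Or.inl hr
  · by_cases hy : y ∈ Q.S
    · exact Or.inl ((h.exists_left_eq hy).imp fun _ => And.right)
    · exact Or.inr ⟨y, hy, rfl⟩

theorem not_prec (h : IsGluing P Q R i j) (x : P.carrier) (y : Q.carrier) :
    ¬ R.prec (j y) (i x) := by
  intro hyx
  by_cases hx : x ∈ P.T
  · obtain ⟨y', hy', e⟩ := h.exists_right_eq hx
    rw [← e, h.right.prec_iff] at hyx
    exact Q.S_minimal _ hy' _ hyx
  by_cases hy : y ∈ Q.S
  · obtain ⟨x', hx', e⟩ := h.exists_left_eq hy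
    rw [← e, h.left.prec_iff] at hyx
    exact P.T_maximal _ hx' _ hyx
  exact prec_asymm hyx (h.prec hx hy)

theorem cases_of_conc (h : IsGluing P Q R i j) {r r' : R.carrier} (hc : R.Conc r r') :
    (∃ x x', i x = r ∧ i x' = r') ∨ ∃ y y', j y = r ∧ j y' = r' := by
  rcases h.cases_left r with ⟨x, rfl⟩ | ⟨y, hy, rfl⟩ <;>
    rcases h.cases_right r' with ⟨y', rfl⟩ | ⟨x', hx', rfl⟩
  · rcases h.cases_right (i x) with ⟨y, hy⟩ | ⟨x₁, hx₁, hx⟩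
    · exact Or.inr ⟨y, y', hy, rfl⟩
    rcases h.cases_left (j y') with ⟨x', hx'⟩ | ⟨y₁, hy₁, hy⟩
    · exact Or.inl ⟨x, x', rfl, hx'⟩
    · exact (hc.1 (hx ▸ hy ▸ h.prec hx₁ hy₁)).elim
  · exact Or.inl ⟨x, x', rfl, rfl⟩
  · exact Or.inr ⟨y, y', rfl, rfl⟩
  · exact (hc.2 (h.prec hx' hy)).elim

theorem exists_desc (h : IsGluing P Q R i j) {X : Type*} {f : P.carrier → X} {g : Q.carrier → X}
    (hfg : ∀ x y, i x = j y → f x = g y) : ∃ e : R.carrier → X, e ∘ i = f ∧ e ∘ j = g := by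
  have key : ∀ r, ∃ z, (∀ x, i x = r → z = f x) ∧ ∀ y, j y = r → z = g y := by
    intro r
    rcases h.cover r with ⟨x, rfl⟩ | ⟨y, rfl⟩
    · exact ⟨f x, fun x' hx' => by rw [h.left.injective hx'], fun y hy => hfg _ _ hy.symm⟩
    · exact ⟨g y, fun x hx => (hfg _ _ hx).symm, fun y' hy' => by rw [h.right.injective hy']⟩
  choose e hi hj using key
  exact ⟨e, funext fun x => hi _ x rfl, funext fun y => hj _ y rfl⟩

theorem isLaxEmbedding_desc (h : IsGluing P Q R i j) {R' : Iposet α} {e : R.carrier → R'.carrier}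
    (hi : IsLaxEmbedding P R' (e ∘ i)) (hj : IsLaxEmbedding Q R' (e ∘ j))
    (hne : ∀ x ∉ P.T, ∀ y, e (i x) ≠ e (j y)) (hprec : ∀ x y, ¬ R'.prec (e (j y)) (e (i x))) :
    IsLaxEmbedding R R' e where
  injective r r' hrr := by
    rcases h.cases_right r with ⟨y, rfl⟩ | ⟨x, hx, rfl⟩ <;>
      rcases h.cases_right r' with ⟨y', rfl⟩ | ⟨x', hx', rfl⟩
    · rw [hj.injective hrr]
    · exact (hne x' hx' y hrr.symm).elim
    · exact (hne x hx y' hrr).elim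
    · rw [hi.injective hrr]
  label r := by
    rcases h.cover r with ⟨x, rfl⟩ | ⟨y, rfl⟩
    · exact (hi.label x).trans (h.left.label x).symm
    · exact (hj.label y).trans (h.right.label y).symm
  prec {r r'} hrr := by
    rcases h.cases_right r with ⟨y, rfl⟩ | ⟨x, hx, rfl⟩ <;>
      rcases h.cases_left r' with ⟨x', rfl⟩ | ⟨y', hy', rfl⟩
    · exact (hprec x' y hrr).elim
    · exact h.right.map_prec (hj.prec hrr)
    · exact h.left.map_prec (hi.prec hrr)
    · exact h.prec hx hy'
  event {r r'} hc hrr := by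
    rcases h.cases_of_conc hc with ⟨x, x', rfl, rfl⟩ | ⟨y, y', rfl, rfl⟩
    · have hc' := h.left.conc_iff.1 hc
      exact hi.event hc' ((h.left.event_iff hc').1 hrr)
    · have hc' := h.right.conc_iff.1 hc
      exact hj.event hc' ((h.right.event_iff hc').1 hrr)

theorem isEmbedding_desc (h : IsGluing P Q R i j) {R' : Iposet α} {e : R.carrier → R'.carrier}
    (hi : IsEmbedding P R' (e ∘ i)) (hj : IsEmbedding Q R' (e ∘ j))
    (hne : ∀ x ∉ P.T, ∀ y, e (i x) ≠ e (j y)) (hnot : ∀ x y, ¬ R'.prec (e (j y)) (e (i x)))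
    (hprec : ∀ x ∉ P.T, ∀ y ∉ Q.S, R'.prec (e (i x)) (e (j y))) : IsEmbedding R R' e where
  toIsLaxEmbedding := h.isLaxEmbedding_desc hi.toIsLaxEmbedding hj.toIsLaxEmbedding hne hnot
  map_prec {r r'} hrr := by
    rcases h.cases_right r with ⟨y, rfl⟩ | ⟨x, hx, rfl⟩ <;>
      rcases h.cases_left r' with ⟨x', rfl⟩ | ⟨y', hy', rfl⟩
    · exact (h.not_prec x' y hrr).elim
    · exact hj.map_prec (h.right.prec hrr)
    · exact hi.map_prec (h.left.prec hrr)
    · exact hprec x hx y' hy'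

end IsGluing

section Glue

variable {P Q : Iposet α} (f : Matching P Q)

theorem glue_prec_inl_iff {x y : P.carrier} :
    (P.glue Q f).prec (Sum.inl x) (Sum.inl y) ↔ P.prec x y := by
  constructor
  · rintro (⟨a, b, h, e, e'⟩ | ⟨a, b, h, _, e'⟩ | ⟨a, b, _, hb, _, e'⟩)
    · cases e; cases e'; exact h
    · exact (Q.S_minimal _ (f.inR_eq_inl e').2 _ h).elim
    · exact (hb (f.inR_eq_inl e').2).elim
  · exact fun h => Or.inl ⟨x, y, h, rfl, rfl⟩

theorem glue_prec_inR_iff {x y : Q.carrier} :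
    (P.glue Q f).prec (f.inR x) (f.inR y) ↔ Q.prec x y := by
  constructor
  · rintro (⟨a, b, h, e, _⟩ | ⟨a, b, h, e, e'⟩ | ⟨a, b, ha, _, e, _⟩)
    · exact (P.T_maximal _ (f.inR_eq_inl e.symm).1 _ h).elim
    · rw [← f.inR_injective e, ← f.inR_injective e']; exact h
    · exact (ha (f.inR_eq_inl e.symm).1).elim
  · exact fun h => Or.inr (Or.inl ⟨x, y, h, rfl, rfl⟩)

theorem isEmbedding_inl : IsEmbedding P (P.glue Q f) Sum.inl where
  injective := Sum.inl_injective
  label _ := rfl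
  prec := (glue_prec_inl_iff f).1
  event _ h := .single (Or.inl ⟨_, _, h, rfl, rfl⟩)
  map_prec := (glue_prec_inl_iff f).2

theorem isEmbedding_inR : IsEmbedding Q (P.glue Q f) f.inR where
  injective := f.inR_injective
  label q := by
    rcases f.inR_cases q with ⟨h, e⟩ | ⟨t, rfl, e⟩
    · rw [e]; rfl
    · rw [e, f.label_eq]; rfl
  prec := (glue_prec_inR_iff f).1
  event _ h := .single (Or.inr ⟨_, _, h, rfl, rfl⟩)
  map_prec := (glue_prec_inR_iff f).2

theorem isGluing_glue : IsGluing P Q (P.glue Q f) Sum.inl f.inR where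
  left := isEmbedding_inl f
  right := isEmbedding_inR f
  image_T := by
    ext r
    constructor
    · rintro ⟨x, hx, rfl⟩
      exact ⟨_, (f.equiv ⟨x, hx⟩).2, f.inR_equiv ⟨x, hx⟩⟩
    · rintro ⟨y, hy, rfl⟩
      obtain ⟨t, rfl⟩ : ∃ t, (f.equiv t : Q.carrier) = y := ⟨f.equiv.symm ⟨y, hy⟩, by simp⟩
      exact ⟨t, t.2, (f.inR_equiv t).symm⟩
  inter h := (f.inR_eq_inl h.symm).1
  cover
    | .inl x => Or.inl ⟨x, rfl⟩
    | .inr y => Or.inr ⟨y, f.inR_of_notMem y.2⟩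
  prec hx hy := Or.inr (Or.inr ⟨_, _, hx, hy, rfl, rfl⟩)
  src := rfl
  tgt := rfl

theorem Marking.inR_matching_emb {U : LoSet α} (s : Marking U P P.T) (t : Marking U Q Q.S)
    (k : Fin U.size) : (s.matching t).inR (t.emb k) = Sum.inl (s.emb k) := by
  have h : t.emb k = (s.matching t).equiv (s.equiv k) := by simp [matching, emb]
  rw [h, Matching.inR_equiv]
  rfl

end Glue

end Iposet

/-! ### Subsumption and alignment -/

theorem compl_range_comp_eq_iff {X Y Z : Type*} {g : Y → Z} (hg : Function.Injective g) {f : X → Y}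
    {s : Set Y} : (Set.range (g ∘ f))ᶜ = g '' s ∪ (Set.range g)ᶜ ↔ (Set.range f)ᶜ = s := by
  rw [Set.range_comp, hg.compl_image_eq]
  refine ⟨fun h => ?_, fun h => by rw [h]⟩
  simpa [Set.preimage_image_eq _ hg] using congrArg (g ⁻¹' ·) h

namespace Iposet

variable {U U₁ V V₁ : LoSet α} {P P₁ Q Q₁ R : Iposet α}

theorem IsEmbedding.comp_isLaxEmbedding_iff {g : Q.carrier → R.carrier} (hg : IsEmbedding Q R g)
    {f : P.carrier → Q.carrier} : IsLaxEmbedding P R (g ∘ f) ↔ IsLaxEmbedding P Q f :=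
  ⟨.of_comp hg, hg.toIsLaxEmbedding.comp⟩

/-- `R` is the gluing of the step that starts the events outside the image of `a` with `P`, the
inclusion of `P` being `j`. -/
structure IsStartGluing (s : Marking U R R.S) (t : Marking V P P.S) (a : U ⟶ V)
    (j : P.carrier → R.carrier) : Prop where
  embedding : IsEmbedding P R j
  surjective : Function.Surjective j
  image_T : j '' P.T = R.T
  src : ∀ k, s.emb k = j (t.emb (Coface.map a k))

/-- `R` is the gluing of the step that terminates the events outside the image of `b` with `P`,
the inclusion of `P` being `j`. -/
structure IsEndGluing (s : Marking U R R.S) (t : Marking V P P.S) (b : V ⟶ U)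
    (j : P.carrier → R.carrier) : Prop where
  embedding : IsEmbedding P R j
  image_T : j '' P.T = R.T
  src : ∀ k, s.emb (Coface.map b k) = j (t.emb k)
  compl_range : (Set.range j)ᶜ = s.emb '' Coface.B b
  prec : ∀ k ∈ Coface.B b, ∀ x ∉ P.S, R.prec (s.emb k) (j x)

namespace IsStartGluing

variable {s : Marking U R R.S} {t : Marking V P P.S} {a : U ⟶ V} {j : P.carrier → R.carrier}

theorem image_emb (h : IsStartGluing s t a j) (B : Set (Fin U.size)) :
    s.emb '' B = j '' (t.emb '' (Coface.map a '' B)) := by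
  simp only [Set.image_image, ← h.src]

theorem isEmbedding_symm (h : IsStartGluing s t a j) :
    IsEmbedding R P (Equiv.ofBijective j ⟨h.embedding.injective, h.surjective⟩).symm :=
  IsEmbedding.symm (e := Equiv.ofBijective j ⟨h.embedding.injective, h.surjective⟩) h.embedding

end IsStartGluing

namespace IsEndGluing

variable {s : Marking U R R.S} {t : Marking V P P.S} {b : V ⟶ U} {j : P.carrier → R.carrier}

theorem image_emb (h : IsEndGluing s t b j) (B : Set (Fin V.size)) :
    s.emb '' (Coface.map b '' B) = j '' (t.emb '' B) := by
  simp only [Set.image_image, h.src]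

theorem prec_of_notMem_S (h : IsEndGluing s t b j) {k : Fin U.size} (hk : k ∈ Coface.B b)
    {r : R.carrier} (hr : r ∉ R.S) : R.prec (s.emb k) r := by
  by_cases hj : r ∈ Set.range j
  · obtain ⟨x, rfl⟩ := hj
    refine h.prec k hk x fun hx => hr ?_
    obtain ⟨i, rfl⟩ := t.exists_emb_eq hx
    rw [← h.src]
    exact s.emb_mem _
  · have hj' : r ∈ (Set.range j)ᶜ := hj
    rw [h.compl_range] at hj'
    obtain ⟨i, -, rfl⟩ := hj'
    exact (hr (s.emb_mem i)).elim

theorem isGluing (h : IsEndGluing s t b j) (hb : Coface.A b = ∅) :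
    IsGluing (discrete U Set.univ (Set.range (Coface.map b))) P R s.emb j := by
  have hB := Coface.B_eq_compl_range hb
  exact
    { left := s.isEmbedding_emb _ _
      right := h.embedding
      image_T := by
        rw [← t.range_emb, ← Set.range_comp]
        exact (Set.range_comp _ _).symm.trans (congrArg Set.range (funext h.src))
      inter := fun {k x} hkx => by
        by_contra hk
        have hx : s.emb k ∈ (Set.range j)ᶜ := h.compl_range ▸ ⟨k, hB ▸ hk, rfl⟩
        exact hx ⟨x, hkx.symm⟩
      cover := fun r => by
        refine or_iff_not_imp_right.2 fun hr => ?_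
        obtain ⟨k, -, rfl⟩ := h.compl_range.subset hr
        exact ⟨k, rfl⟩
      prec := fun {k x} hk hx => h.prec k (hB ▸ hk) x hx
      src := Set.image_univ.trans s.range_emb
      tgt := h.image_T }

end IsEndGluing

/-- Subsumption relative to delayed and advanced events: `f` exhibits the events of `P` as the
events of `Q` that are not yet terminated in `P`. The coface map `d` relates the source interfaces:
its `A` consists of the source events of `Q` whose start is delayed in `P`, its `B` of those already
terminated. -/
structure IsPartialSubsumption (s : Marking U P P.S) (t : Marking V Q Q.S) (d : U ⟶ V)
    (f : P.carrier → Q.carrier) : Prop where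
  isLaxEmbedding : IsLaxEmbedding P Q f
  image_T : f '' P.T = Q.T
  src : ∀ k, f (s.emb k) = t.emb (Coface.map d k)
  compl_range : (Set.range f)ᶜ = t.emb '' Coface.B d

namespace IsPartialSubsumption

variable {s : Marking U P P.S} {t : Marking V Q Q.S} {s₁ : Marking U₁ P₁ P₁.S}
  {t₁ : Marking V₁ Q₁ Q₁.S}

theorem mem_B_iff {d : U ⟶ V} {f : P.carrier → Q.carrier} (h : IsPartialSubsumption s t d f)
    {k : Fin V.size} : k ∈ Coface.B d ↔ t.emb k ∉ Set.range f := by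
  rw [← Set.mem_compl_iff, h.compl_range, t.emb_injective.mem_set_image]

theorem startRight_iff {a : V ⟶ V₁} (ha : Coface.B a = ∅) {j : Q₁.carrier → Q.carrier}
    (hj : IsStartGluing t t₁ a j) {d : U ⟶ V} {f : P.carrier → Q₁.carrier} :
    IsPartialSubsumption s t d (j ∘ f) ↔ IsPartialSubsumption s t₁ (d ≫ a) f := by
  have hT : (j ∘ f) '' P.T = Q.T ↔ f '' P.T = Q₁.T := by
    rw [Set.image_comp, ← hj.image_T, hj.embedding.injective.image_injective.eq_iff]
  have hS : (∀ k, j (f (s.emb k)) = t.emb (Coface.map d k)) ↔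
      ∀ k, f (s.emb k) = t₁.emb (Coface.map (d ≫ a) k) := by
    simp only [hj.src, hj.embedding.injective.eq_iff, Coface.comp_map]
  have hB : (Set.range (j ∘ f))ᶜ = t.emb '' Coface.B d ↔
      (Set.range f)ᶜ = t₁.emb '' Coface.B (d ≫ a) := by
    rw [← compl_range_comp_eq_iff hj.embedding.injective, hj.surjective.range_eq, Set.compl_univ,
      Set.union_empty, Coface.comp_B, ha, Set.union_empty, ← hj.image_emb]
  have hf := hj.embedding.comp_isLaxEmbedding_iff (f := f)
  exact ⟨fun h => ⟨hf.1 h.1, hT.1 h.2, hS.1 h.3, hB.1 h.4⟩,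
    fun h => ⟨hf.2 h.1, hT.2 h.2, hS.2 h.3, hB.2 h.4⟩⟩

theorem endRight_iff {b : V₁ ⟶ V} {j : Q₁.carrier → Q.carrier} (hj : IsEndGluing t t₁ b j)
    {d : U ⟶ V₁} {f : P.carrier → Q₁.carrier} :
    IsPartialSubsumption s t (d ≫ b) (j ∘ f) ↔ IsPartialSubsumption s t₁ d f := by
  have hT : (j ∘ f) '' P.T = Q.T ↔ f '' P.T = Q₁.T := by
    rw [Set.image_comp, ← hj.image_T, hj.embedding.injective.image_injective.eq_iff]
  have hS : (∀ k, j (f (s.emb k)) = t.emb (Coface.map (d ≫ b) k)) ↔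
      ∀ k, f (s.emb k) = t₁.emb (Coface.map d k) := by
    simp only [Coface.comp_map, hj.src, hj.embedding.injective.eq_iff]
  have hB : (Set.range (j ∘ f))ᶜ = t.emb '' Coface.B (d ≫ b) ↔
      (Set.range f)ᶜ = t₁.emb '' Coface.B d := by
    rw [← compl_range_comp_eq_iff hj.embedding.injective, Coface.comp_B, Set.image_union,
      hj.image_emb, hj.compl_range]
  have hf := hj.embedding.comp_isLaxEmbedding_iff (f := f)
  exact ⟨fun h => ⟨hf.1 h.1, hT.1 h.2, hS.1 h.3, hB.1 h.4⟩,
    fun h => ⟨hf.2 h.1, hT.2 h.2, hS.2 h.3, hB.2 h.4⟩⟩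

theorem of_startRight {a : V ⟶ V₁} (ha : Coface.B a = ∅) {j : Q₁.carrier → Q.carrier}
    (hj : IsStartGluing t t₁ a j) {d : U ⟶ V} {f : P.carrier → Q.carrier}
    (h : IsPartialSubsumption s t d f) : ∃ f₁, IsPartialSubsumption s t₁ (d ≫ a) f₁ := by
  obtain ⟨f₁, rfl⟩ := hj.surjective.comp_left f
  exact ⟨f₁, (startRight_iff ha hj).1 h⟩

theorem of_endRight {b : V₁ ⟶ V} (hb : Coface.A b = ∅) {j : Q₁.carrier → Q.carrier}
    (hj : IsEndGluing t t₁ b j) {d : U ⟶ V} {f : P.carrier → Q.carrier}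
    (h : IsPartialSubsumption s t d f) (hd : Coface.B b ⊆ Coface.B d) :
    ∃ d₁ f₁, d₁ ≫ b = d ∧ IsPartialSubsumption s t₁ d₁ f₁ := by
  obtain ⟨d, rfl⟩ := Coface.exists_comp_eq_of_subset d b (by simp [hb]) hd
  have hr : Set.range f ⊆ Set.range j := by
    rw [← Set.compl_subset_compl, h.compl_range, hj.compl_range]
    exact Set.image_mono hd
  obtain ⟨f₁, rfl⟩ : ∃ f₁, j ∘ f₁ = f := (Set.range_subset_range_iff_exists_comp.1 hr).imp
    fun _ => Eq.symm
  exact ⟨d, f₁, rfl, (endRight_iff hj).1 h⟩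

theorem startLeft {a : U ⟶ U₁} (ha : Coface.B a = ∅) {j : P₁.carrier → P.carrier}
    (hj : IsStartGluing s s₁ a j) {d : U₁ ⟶ V} {f : P₁.carrier → Q.carrier}
    (h : IsPartialSubsumption s₁ t d f) : ∃ f', IsPartialSubsumption s t (a ≫ d) f' := by
  let e := Equiv.ofBijective j ⟨hj.embedding.injective, hj.surjective⟩
  have he : ∀ x, e.symm (j x) = x := e.symm_apply_apply
  refine ⟨f ∘ e.symm, h.isLaxEmbedding.comp hj.isEmbedding_symm.toIsLaxEmbedding, ?_, ?_, ?_⟩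
  · rw [← hj.image_T, ← Set.image_comp, ← h.image_T]
    exact congrArg (· '' P₁.T) (funext fun x => congrArg f (he x))
  · exact fun k => by rw [hj.src, Function.comp_apply, he, h.src, Coface.comp_map]
  · rw [e.symm.surjective.range_comp, h.compl_range, Coface.comp_B, ha, Set.image_empty,
      Set.empty_union]

theorem endLeft {b : U₁ ⟶ U} (hb : Coface.A b = ∅) {j : P₁.carrier → P.carrier}
    (hj : IsEndGluing s s₁ b j) {d : U ⟶ V} {f₁ : P₁.carrier → Q.carrier}
    (h : IsPartialSubsumption s₁ t (b ≫ d) f₁) : ∃ f, IsPartialSubsumption s t d f := by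
  have G := hj.isGluing hb
  obtain ⟨f, hfs, rfl⟩ := G.exists_desc (f := t.emb ∘ Coface.map d) (g := f₁) (by
    rintro k x hkx
    obtain ⟨i, rfl⟩ := G.inter hkx
    rw [hj.src, hj.embedding.injective.eq_iff] at hkx
    rw [← hkx, h.src, Coface.comp_map]
    rfl)
  have hB : Coface.B (b ≫ d) \ Set.range (Coface.map d) = Coface.B d := by
    rw [Coface.comp_B, Set.union_sdiff_distrib,
      Set.sdiff_eq_empty.2 (Set.image_subset_range _ _), Set.empty_union, sdiff_eq_left,
      Set.disjoint_right]
    rintro _ ⟨i, rfl⟩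
    exact d.map_notMem_B i
  have hrange : Set.range f = Set.range (f ∘ j) ∪ Set.range (t.emb ∘ Coface.map d) := by
    refine subset_antisymm ?_ (Set.union_subset (Set.range_comp_subset_range _ _)
      (hfs ▸ Set.range_comp_subset_range _ _))
    rintro _ ⟨r, rfl⟩
    rcases G.cover r with ⟨k, rfl⟩ | ⟨x, rfl⟩
    · exact Or.inr ⟨k, (congrFun hfs k).symm⟩
    · exact Or.inl ⟨x, rfl⟩
  refine ⟨f, G.isLaxEmbedding_desc ?_ h.isLaxEmbedding ?_ ?_, ?_, congrFun hfs, ?_⟩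
  · rw [hfs]
    exact (t.isEmbedding_emb Set.univ ∅).toIsLaxEmbedding.comp (isLaxEmbedding_cofaceMap d _ _ _ _)
  · intro k hk x hkx
    have hkB : Coface.map d k ∈ Coface.B (b ≫ d) :=
      Or.inl ⟨k, (Coface.B_eq_compl_range hb).symm.subset hk, rfl⟩
    exact h.mem_B_iff.1 hkB ⟨x, hkx.symm.trans (congrFun hfs k)⟩
  · intro k x
    rw [show f (s.emb k) = t.emb (Coface.map d k) from congrFun hfs k]
    exact Q.S_minimal _ (t.emb_mem _) _
  · rw [← hj.image_T, ← Set.image_comp, h.image_T]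
  · rw [hrange, Set.compl_union, h.compl_range, ← Set.sdiff_eq, Set.range_comp,
      ← Set.image_sdiff t.emb_injective, hB]

theorem of_startLeft {a : U ⟶ U₁} (ha : Coface.B a = ∅) {j : P₁.carrier → P.carrier}
    (hj : IsStartGluing s s₁ a j) {d : U ⟶ V} {f : P.carrier → Q.carrier}
    (h : IsPartialSubsumption s t d f) (hS : ∀ k, f (j (s₁.emb k)) ∈ Q.S) :
    ∃ d₁ f₁, a ≫ d₁ = d ∧ IsPartialSubsumption s₁ t d₁ f₁ := by
  have hfj := h.isLaxEmbedding.comp hj.embedding.toIsLaxEmbedding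
  choose g hg using fun k => t.exists_emb_eq (hS k)
  have hmono : StrictMono g := by
    intro k l hkl
    rw [← t.event_emb_iff, hg, hg]
    exact hfj.event (conc_of_mem_S (s₁.emb_mem k) (s₁.emb_mem l)) (s₁.event_emb_iff.2 hkl)
  have hlabel : ∀ k, V.label (g k) = U₁.label k := fun k => by
    rw [← t.label_emb, hg, ← s₁.label_emb]
    exact hfj.label _
  have hgB : ∀ k, g k ∉ Coface.B d := fun k hk => h.mem_B_iff.1 hk ⟨_, (hg k).symm⟩
  refine ⟨Coface.ofMap g hmono hlabel (Coface.B d) hgB, f ∘ j,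
    Coface.ext_map_B (fun k => t.emb_injective ?_) ?_, hfj, ?_, fun k => (hg k).symm, ?_⟩
  · rw [← h.src, hj.src, ← hg]
    rfl
  · rw [Coface.comp_B, ha, Set.image_empty, Set.empty_union]
    rfl
  · rw [Set.image_comp, hj.image_T, h.image_T]
  · rw [hj.surjective.range_comp, h.compl_range]
    rfl

theorem of_endLeft {b : U₁ ⟶ U} {j : P₁.carrier → P.carrier} (hj : IsEndGluing s s₁ b j)
    {d : U ⟶ V} {f : P.carrier → Q.carrier} (h : IsPartialSubsumption s t d f) :
    IsPartialSubsumption s₁ t (b ≫ d) (f ∘ j) where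
  isLaxEmbedding := h.isLaxEmbedding.comp hj.embedding.toIsLaxEmbedding
  image_T := by rw [Set.image_comp, hj.image_T, h.image_T]
  src k := by rw [Function.comp_apply, ← hj.src, h.src, Coface.comp_map]
  compl_range := by
    rw [Set.range_comp, h.isLaxEmbedding.injective.compl_image_eq, hj.compl_range, h.compl_range,
      Coface.comp_B, Set.image_union]
    simp only [Set.image_image, h.src]

theorem B_subset_of_T_eq_univ {b : V₁ ⟶ V} {j : Q₁.carrier → Q.carrier} (hj : IsEndGluing t t₁ b j)
    {d : U ⟶ V} {f : P.carrier → Q.carrier} (h : IsPartialSubsumption s t d f)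
    (hT : P.T = Set.univ) : Coface.B b ⊆ Coface.B d := by
  intro k hk
  have hr : Set.range f ⊆ Set.range j := by
    rw [← Set.image_univ, ← hT, h.image_T, ← hj.image_T]
    exact Set.image_subset_range _ _
  have hkj : t.emb k ∈ (Set.range j)ᶜ := hj.compl_range ▸ Set.mem_image_of_mem _ hk
  exact h.mem_B_iff.2 fun hkf => hkj (hr hkf)

theorem B_subset_of_minimal {b : V₁ ⟶ V} {j : Q₁.carrier → Q.carrier} (hj : IsEndGluing t t₁ b j)
    {d : U ⟶ V} {f : P.carrier → Q.carrier} (h : IsPartialSubsumption s t d f) {x : P.carrier}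
    (hx : ∀ y, ¬ P.prec y x) (hxS : f x ∉ Q.S) : Coface.B b ⊆ Coface.B d := by
  refine fun k hk => h.mem_B_iff.2 fun ⟨y, hy⟩ => hx y (h.isLaxEmbedding.prec ?_)
  rw [hy]
  exact hj.prec_of_notMem_S hk hxS

end IsPartialSubsumption

end Iposet

namespace StepWord

open Iposet

/-- The iposet of a step word, with its source interface. -/
noncomputable def evAux : {U W : LoSet α} → StepWord α U W →
    Σ P : Iposet α, Marking U P P.S
  | _, _, .nil U => ⟨discrete U Set.univ Set.univ, Marking.univ _ _ _⟩
  | _, _, .up (V := V) a _ w =>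
    let f : Matching (discrete V (Set.range (Coface.map a)) Set.univ) w.evAux.1 :=
      (Marking.univ V (Set.range (Coface.map a)) Set.univ).matching w.evAux.2
    ⟨Iposet.glue _ _ f, (Marking.range a _ _).glue f⟩
  | U, _, .down b _ w =>
    let f : Matching (discrete U Set.univ (Set.range (Coface.map b))) w.evAux.1 :=
      (Marking.range b Set.univ (Set.range (Coface.map b))).matching w.evAux.2
    ⟨Iposet.glue _ _ f, (Marking.univ U Set.univ _).glue f⟩

/-- The iposet of a step word. -/
noncomputable abbrev iposet {U W : LoSet α} (w : StepWord α U W) : Iposet α := w.evAux.1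

/-- The source interface of the iposet of a step word. -/
noncomputable abbrev src {U W : LoSet α} (w : StepWord α U W) :
    Marking U w.iposet w.iposet.S := w.evAux.2

variable {U V W W' : LoSet α}

theorem exists_isStartGluing (a : U ⟶ V) (ha : Coface.B a = ∅) (w : StepWord α V W) :
    ∃ j, IsStartGluing (up a ha w).src w.src a j := by
  let f : Matching (discrete V (Set.range (Coface.map a)) Set.univ) w.iposet :=
    (Marking.univ V _ _).matching w.src
  have hsrc : ∀ k, f.inR (w.src.emb k) = Sum.inl k :=
    Marking.inR_matching_emb (Marking.univ V (Set.range (Coface.map a)) Set.univ) w.src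
  refine ⟨f.inR, isEmbedding_inR f, fun r => ?_, (isGluing_glue f).tgt, fun k => (hsrc _).symm⟩
  rcases (isGluing_glue f).cover r with ⟨k, rfl⟩ | h
  · exact ⟨_, hsrc k⟩
  · exact h

theorem exists_isEndGluing (b : V ⟶ U) (hb : Coface.A b = ∅) (w : StepWord α V W) :
    ∃ j, IsEndGluing (down b hb w).src w.src b j := by
  let f : Matching (discrete U Set.univ (Set.range (Coface.map b))) w.iposet :=
    (Marking.range b _ _).matching w.src
  have G := isGluing_glue f
  have hB := Coface.B_eq_compl_range hb
  refine ⟨f.inR, G.right, G.tgt, fun k => (Marking.inR_matching_emb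
    (P := discrete U Set.univ (Set.range (Coface.map b))) (Marking.range b _ _) w.src k).symm,
    ?_, fun k hk x hx => G.prec (hB.subset hk) hx⟩
  rw [hB]
  ext r
  constructor
  · intro hr
    obtain ⟨k, rfl⟩ := (G.cover r).resolve_right hr
    exact ⟨k, fun hk => hr ((G.exists_right_eq hk).imp fun _ => And.right), rfl⟩
  · rintro ⟨k, hk, rfl⟩ ⟨x, hx⟩
    exact hk (G.inter hx.symm)

theorem Align.exists_isPartialSubsumption {w : StepWord α U W} {v : StepWord α V W'} {d : U ⟶ V}
    (h : Align w v d) : ∃ f, IsPartialSubsumption w.src v.src d f := by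
  induction h with
  | nil U =>
    exact ⟨id, (IsEmbedding.id _).toIsLaxEmbedding, Set.image_id _, fun _ => rfl, by simp⟩
  | startRight a ha _ ih =>
    obtain ⟨f, hf⟩ := ih
    obtain ⟨j, hj⟩ := exists_isStartGluing a ha _
    exact ⟨_, (IsPartialSubsumption.startRight_iff ha hj).2 hf⟩
  | endRight b hb _ ih =>
    obtain ⟨f, hf⟩ := ih
    obtain ⟨j, hj⟩ := exists_isEndGluing b hb _
    exact ⟨_, (IsPartialSubsumption.endRight_iff hj).2 hf⟩
  | startLeft a ha _ ih =>
    obtain ⟨f, hf⟩ := ih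
    obtain ⟨j, hj⟩ := exists_isStartGluing a ha _
    exact hf.startLeft ha hj
  | endLeft b hb _ ih =>
    obtain ⟨f, hf⟩ := ih
    obtain ⟨j, hj⟩ := exists_isEndGluing b hb _
    exact hf.endLeft hb hj

theorem align_nil_nil {d : U ⟶ V} {f : (nil U).iposet.carrier → (nil V).iposet.carrier}
    (h : IsPartialSubsumption (nil U).src (nil V).src d f) : Align (nil U) (nil V) d := by
  have hf : Set.range f = Set.univ := Set.image_univ.symm.trans h.image_T
  have hB : Coface.B d = ∅ := Set.eq_empty_of_forall_notMem fun k hk =>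
    h.mem_B_iff.1 hk (hf ▸ Set.mem_univ _)
  have hd : Set.range (Coface.map d) = Set.univ :=
    (congrArg Set.range (funext fun k => (h.src k).symm)).trans hf
  have hA : Coface.A d = ∅ := by
    rw [Coface.A_eq_compl_range_sdiff]
    exact (congrArg (·ᶜ \ Coface.B d) hd).trans (by simp)
  obtain ⟨rfl, rfl⟩ := Coface.exists_eq_eqToHom hA hB
  exact .nil U

theorem align_nil_left (v : StepWord α V W') {d : U ⟶ V}
    {f : (nil U).iposet.carrier → v.iposet.carrier}
    (h : IsPartialSubsumption (nil U).src v.src d f) : Align (nil U) v d := by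
  induction v with
  | nil V => exact align_nil_nil h
  | up a ha v ih =>
    obtain ⟨j, hj⟩ := exists_isStartGluing a ha v
    obtain ⟨f₁, h₁⟩ := h.of_startRight ha hj
    exact .startRight a ha (ih h₁)
  | down b hb v ih =>
    obtain ⟨j, hj⟩ := exists_isEndGluing b hb v
    obtain ⟨d₁, f₁, rfl, h₁⟩ := h.of_endRight hb hj
      (IsPartialSubsumption.B_subset_of_T_eq_univ hj h rfl)
    exact .endRight b hb (ih h₁)

/-- The key case: the larger word proceeds first, as long as it can without waiting for events that
are delayed in the smaller word. -/
theorem align_up_left {U₁ : LoSet α} {a : U ⟶ U₁} {ha : Coface.B a = ∅} {w : StepWord α U₁ W}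
    (ihw : ∀ {V W' : LoSet α} (v : StepWord α V W') {d : U₁ ⟶ V}
      {f : w.iposet.carrier → v.iposet.carrier}, IsPartialSubsumption w.src v.src d f → Align w v d)
    (v : StepWord α V W') {d : U ⟶ V} {f : (up a ha w).iposet.carrier → v.iposet.carrier}
    (h : IsPartialSubsumption (up a ha w).src v.src d f) : Align (up a ha w) v d := by
  obtain ⟨i, hi⟩ := exists_isStartGluing a ha w
  induction v with
  | nil V =>
    obtain ⟨d₁, f₁, rfl, h₁⟩ := h.of_startLeft ha hi fun _ => Set.mem_univ _
    exact .startLeft a ha (ihw _ h₁)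
  | up a' ha' v ih =>
    obtain ⟨j, hj⟩ := exists_isStartGluing a' ha' v
    obtain ⟨f₁, h₁⟩ := h.of_startRight ha' hj
    exact .startRight a' ha' (ih h₁)
  | down b hb v ih =>
    obtain ⟨j, hj⟩ := exists_isEndGluing b hb v
    by_cases hS : ∀ k, f (i (w.src.emb k)) ∈ (down b hb v).iposet.S
    · obtain ⟨d₁, f₁, rfl, h₁⟩ := h.of_startLeft ha hi hS
      exact .startLeft a ha (ihw _ h₁)
    · obtain ⟨k, hk⟩ := not_forall.1 hS
      have hmin : ∀ y, ¬ (up a ha w).iposet.prec y (i (w.src.emb k)) := fun y hy => by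
        obtain ⟨x, rfl⟩ := hi.surjective y
        exact w.iposet.S_minimal _ (w.src.emb_mem k) x (hi.embedding.prec hy)
      obtain ⟨d₁, f₁, rfl, h₁⟩ := h.of_endRight hb hj
        (IsPartialSubsumption.B_subset_of_minimal hj h hmin hk)
      exact .endRight b hb (ih h₁)

theorem align_of_isPartialSubsumption (w : StepWord α U W) {V W' : LoSet α} (v : StepWord α V W')
    {d : U ⟶ V} {f : w.iposet.carrier → v.iposet.carrier}
    (h : IsPartialSubsumption w.src v.src d f) : Align w v d := by
  induction w generalizing V W' with
  | nil U => exact align_nil_left v h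
  | up a ha w ih => exact align_up_left ih v h
  | down b hb w ih =>
    obtain ⟨j, hj⟩ := exists_isEndGluing b hb w
    exact .endLeft b hb (ih _ (h.of_endLeft hj))

end StepWord

namespace Iposet

variable {U V : LoSet α} {P Q : Iposet α}

theorem IsPartialSubsumption.subsumed {s : Marking U P P.S} {t : Marking U Q Q.S}
    {f : P.carrier → Q.carrier} (h : IsPartialSubsumption s t (𝟙 U) f) : P.Subsumed Q := by
  have hf := h.isLaxEmbedding
  have hsurj : Function.Surjective f := by
    rw [← Set.range_eq_univ, ← Set.compl_empty_iff, h.compl_range, Coface.id_B, Set.image_empty]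
  have hS : f '' P.S = Q.S := by
    rw [← s.range_emb, ← t.range_emb, ← Set.range_comp]
    exact congrArg Set.range (funext h.src)
  exact ⟨Equiv.ofBijective f ⟨hf.injective, hsurj⟩, hS, h.image_T, hf.label, fun _ _ => hf.prec,
    fun _ _ hxy h₁ h₂ => hf.event ⟨h₁, h₂⟩ hxy⟩

theorem Marking.eq_of_iso {I : Set P.carrier} {J : Set Q.carrier} (s : Marking U P I)
    (t : Marking V Q J) (f : I ≃ J) (hf : ∀ x y : I, P.event x y → Q.event (f x) (f y))
    (hl : ∀ x : I, Q.label (f x) = P.label x) :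
    ∃ h : U = V, ∀ k, (f (s.equiv k) : Q.carrier) = t.emb (Coface.map (eqToHom h) k) := by
  let g := (s.equiv.trans f).trans t.equiv.symm
  have hg : ∀ k, t.equiv (g k) = f (s.equiv k) := fun k => by simp [g]
  have hmono : StrictMono g := fun i j hij => by
    rw [t.event_iff, hg, hg]
    exact hf _ _ ((s.event_iff i j).1 hij)
  have hlabel : ∀ i, V.label (g i) = U.label i := fun i => by
    rw [← t.label_eq, hg, hl, s.label_eq]
  let c : U ⟶ V := Coface.ofMap g hmono hlabel ∅ fun _ => Set.notMem_empty _
  have hA : Coface.A c = ∅ := by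
    rw [Coface.A_eq_compl_range_sdiff]
    exact (congrArg (·ᶜ \ ∅) g.surjective.range_eq).trans (by simp)
  obtain ⟨h, hc⟩ := Coface.exists_eq_eqToHom hA rfl
  exact ⟨h, fun k => hc ▸ congrArg Subtype.val (hg k).symm⟩

theorem Subsumed.exists_isPartialSubsumption (h : P.Subsumed Q) (s : Marking U P P.S)
    (t : Marking V Q Q.S) : ∃ e : U = V, ∃ f, IsPartialSubsumption s t (eqToHom e) f := by
  obtain ⟨f, hf⟩ := h
  have hS : ∀ x, x ∈ P.S ↔ f x ∈ Q.S := fun x => by rw [← hf.src, f.injective.mem_set_image]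
  obtain ⟨rfl, hst⟩ := s.eq_of_iso t (f.subtypeEquiv hS)
    (fun x y => hf.isLaxEmbedding.event (conc_of_mem_S x.2 y.2)) fun x => hf.label x
  refine ⟨rfl, f, hf.isLaxEmbedding, hf.tgt, hst, ?_⟩
  rw [f.surjective.range_eq, eqToHom_refl, Coface.id_B, Set.image_empty, Set.compl_univ]

/-- A round trip of subsumptions is a permutation that reflects precedence; it preserves precedence
because there are only finitely many pairs of events. -/
theorem Subsumed.isomorphic (h : P.Subsumed Q) (h' : Q.Subsumed P) : P.Isomorphic Q := by
  obtain ⟨f, hf⟩ := h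
  obtain ⟨g, hg⟩ := h'
  have := P.finite
  let r : P.carrier × P.carrier → P.carrier × P.carrier := Prod.map (f.trans g) (f.trans g)
  let precPairs : Set (P.carrier × P.carrier) := {x | P.prec x.1 x.2}
  have hr : Function.Injective r := (f.trans g).injective.prodMap (f.trans g).injective
  have hsub : r ⁻¹' precPairs ⊆ precPairs := fun x hx => hf.prec _ _ (hg.prec _ _ hx)
  have hcard : (r ⁻¹' precPairs).ncard = precPairs.ncard :=
    Set.ncard_preimage_of_injective_subset_range hr
      ((Finite.surjective_of_injective hr).range_eq ▸ Set.subset_univ _)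
  have heq : r ⁻¹' precPairs = precPairs :=
    Set.eq_of_subset_of_ncard_le hsub hcard.ge (Set.toFinite _)
  refine ⟨f, hf, fun x y hxy => ?_⟩
  have hmem : (x, y) ∈ r ⁻¹' precPairs := heq.superset hxy
  exact hg.prec _ _ hmem

end Iposet

theorem StepWord.subsumed_iff_align {U V W W' : LoSet α} (w : StepWord α U W)
    (v : StepWord α V W') : w.iposet.Subsumed v.iposet ↔ ∃ e : U = V, Align w v (eqToHom e) := by
  constructor
  · intro h
    obtain ⟨e, f, hf⟩ := h.exists_isPartialSubsumption w.src v.src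
    exact ⟨e, align_of_isPartialSubsumption w v hf⟩
  · rintro ⟨rfl, h⟩
    obtain ⟨f, hf⟩ := h.exists_isPartialSubsumption
    exact hf.subsumed

/-! ### Interval ipomsets are the ipomsets of words -/

namespace Iposet

variable {P Q R : Iposet α}

theorem isInterval_discrete (U : LoSet α) (S T : Set (Fin U.size)) :
    (discrete U S T).IsInterval :=
  ⟨0, 0, fun _ => le_rfl, fun _ _ => iff_of_false id (lt_irrefl _)⟩

/-- The intervals of `P` are squeezed into the negative half-line, those of `Q` into the positive
one. -/
theorem IsGluing.isInterval {i : P.carrier → R.carrier} {j : Q.carrier → R.carrier}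
    (h : IsGluing P Q R i j) (hP : P.IsInterval) (hQ : Q.IsInterval) : R.IsInterval := by
  obtain ⟨b₁, e₁, hbe₁, hp₁⟩ := hP
  obtain ⟨b₂, e₂, hbe₂, hp₂⟩ := hQ
  let neg (t : ℝ) : ℝ := -Real.exp (-t)
  have neg_lt {t u : ℝ} : neg t < neg u ↔ t < u := by simp [neg]
  have neg_lt_exp (t u : ℝ) : neg t < Real.exp u :=
    (neg_lt_zero.2 (Real.exp_pos _)).trans (Real.exp_pos _)
  let b := Function.extend i (neg ∘ b₁) (Function.extend j (Real.exp ∘ b₂) 0)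
  let e := Function.extend j (Real.exp ∘ e₂) (Function.extend i (neg ∘ e₁) 0)
  have hbi (x) : b (i x) = neg (b₁ x) := h.left.injective.extend_apply _ _ x
  have hej (y) : e (j y) = Real.exp (e₂ y) := h.right.injective.extend_apply _ _ y
  have hbj (y) (hy : y ∉ Q.S) : b (j y) = Real.exp (b₂ y) :=
    (Function.extend_apply' _ _ _ fun ⟨_, hx⟩ => hy (h.mem_S_of_eq hx)).trans
      (h.right.injective.extend_apply _ _ y)
  have hei (x) (hx : x ∉ P.T) : e (i x) = neg (e₁ x) :=
    (Function.extend_apply' _ _ _ fun ⟨_, hy⟩ => hx (h.inter hy.symm)).trans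
      (h.left.injective.extend_apply _ _ x)
  refine ⟨b, e, fun r => ?_, fun r r' => ?_⟩
  · rcases h.cases_left r with ⟨x, rfl⟩ | ⟨y, hy, rfl⟩
    · rcases h.cases_right (i x) with ⟨y, hyx⟩ | ⟨x', hx', hxx'⟩
      · rw [hbi, ← hyx, hej]
        exact (neg_lt_exp _ _).le
      · obtain rfl := h.left.injective hxx'
        rw [hbi, hei _ hx']
        exact le_of_not_gt (mt neg_lt.1 (hbe₁ _).not_gt)
    · rw [hbj y hy, hej]
      exact Real.exp_le_exp.2 (hbe₂ y)
  · rcases h.cases_right r with ⟨y, rfl⟩ | ⟨x, hx, rfl⟩ <;>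
      rcases h.cases_left r' with ⟨x', rfl⟩ | ⟨y', hy', rfl⟩
    · rw [hej, hbi]
      exact iff_of_false (h.not_prec _ _) (neg_lt_exp _ _).not_gt
    · rw [hej, hbj y' hy', Real.exp_lt_exp, h.right.prec_iff, hp₂]
    · rw [hei x hx, hbi, neg_lt, h.left.prec_iff, hp₁]
    · rw [hei x hx, hbj y' hy']
      exact iff_of_true (h.prec hx hy') (neg_lt_exp _ _)

end Iposet

theorem StepWord.isInterval {U W : LoSet α} (w : StepWord α U W) : w.iposet.IsInterval := by
  induction w with
  | nil U => exact Iposet.isInterval_discrete _ _ _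
  | up _ _ _ ih => exact (Iposet.isGluing_glue _).isInterval (Iposet.isInterval_discrete _ _ _) ih
  | down _ _ _ ih =>
    exact (Iposet.isGluing_glue _).isInterval (Iposet.isInterval_discrete _ _ _) ih

namespace Iposet

variable {U V : LoSet α} {P Q : Iposet α}

theorem exists_marking {I : Set P.carrier} (hI : ∀ x ∈ I, ∀ y ∈ I, P.Conc x y) :
    ∃ U : LoSet α, Nonempty (Marking U P I) := by
  classical
  have := P.finite
  have : Fintype I := Fintype.ofFinite _
  let r : I → I → Prop := fun x y => P.event x y
  have : IsStrictTotalOrder I r :=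
    { trichotomous := fun x y h h' => Subtype.ext
        ((hI x x.2 y y.2).event_trichotomy.resolve_right (not_or_intro h h'))
      irrefl := fun _ => P.event_irrefl _
      trans := fun _ _ _ => P.event_trans _ _ _ }
  let : LinearOrder I := linearOrderOfSTO r
  let e : Fin (Fintype.card I) ≃o I := Fintype.orderIsoFinOfCardEq I rfl
  exact ⟨⟨Fintype.card I, fun i => P.label (e i)⟩,
    ⟨⟨e.toEquiv, fun _ _ => e.lt_iff_lt.symm, fun _ => rfl⟩⟩⟩

/-- An iposet with marked source interface is realized if it agrees with the iposet of some step
word, subsumptions in both directions being compatible with the markings. -/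
def IsRealized (s : Marking U P P.S) : Prop :=
  ∃ (W : LoSet α) (w : StepWord α U W), (∃ f, IsPartialSubsumption s w.src (𝟙 U) f) ∧
    ∃ f, IsPartialSubsumption w.src s (𝟙 U) f

theorem IsRealized.start {s : Marking U P P.S} {t : Marking V Q Q.S} {a : U ⟶ V}
    (ha : Coface.B a = ∅) {j : Q.carrier → P.carrier} (hj : IsStartGluing s t a j)
    (h : IsRealized t) : IsRealized s := by
  obtain ⟨W, w, ⟨f, hf⟩, ⟨g, hg⟩⟩ := h
  obtain ⟨i, hi⟩ := StepWord.exists_isStartGluing a ha w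
  obtain ⟨f', hf'⟩ := hf.startLeft ha hj
  obtain ⟨g', hg'⟩ := hg.startLeft ha hi
  exact ⟨W, .up a ha w,
    ⟨_, (IsPartialSubsumption.startRight_iff (d := 𝟙 U) ha hi).2 (by simpa using hf')⟩,
    ⟨_, (IsPartialSubsumption.startRight_iff (d := 𝟙 U) ha hj).2 (by simpa using hg')⟩⟩

theorem IsRealized.finish {s : Marking U P P.S} {t : Marking V Q Q.S} {b : V ⟶ U}
    (hb : Coface.A b = ∅) {j : Q.carrier → P.carrier} (hj : IsEndGluing s t b j)
    (h : IsRealized t) : IsRealized s := by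
  obtain ⟨W, w, ⟨f, hf⟩, ⟨g, hg⟩⟩ := h
  obtain ⟨i, hi⟩ := StepWord.exists_isEndGluing b hb w
  have hf' := (IsPartialSubsumption.endRight_iff hi).2 hf
  have hg' := (IsPartialSubsumption.endRight_iff hj).2 hg
  exact ⟨W, .down b hb w, IsPartialSubsumption.endLeft (d := 𝟙 U) hb hj (by simpa using hf'),
    IsPartialSubsumption.endLeft (d := 𝟙 U) hb hi (by simpa using hg')⟩

theorem isRealized_of_eq_univ (s : Marking U P P.S) (hS : P.S = Set.univ) (hT : P.T = Set.univ) :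
    IsRealized s := by
  have hs : Set.range s.emb = Set.univ := s.range_emb.trans hS
  let e := Equiv.ofBijective s.emb ⟨s.emb_injective, Set.range_eq_univ.1 hs⟩
  have he : IsEmbedding (StepWord.nil U).iposet P e := s.isEmbedding_emb _ _
  refine ⟨U, .nil U, ⟨e.symm, he.symm.toIsLaxEmbedding, ?_, e.symm_apply_apply, ?_⟩,
    ⟨e, he.toIsLaxEmbedding, ?_, fun _ => rfl, ?_⟩⟩
  · exact (congrArg _ hT).trans (Set.image_univ.trans e.symm.range_eq_univ)
  · exact (congrArg _ e.symm.range_eq_univ).trans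
      (Set.compl_univ.trans (Set.image_empty _).symm)
  · exact Set.image_univ.trans (hs.trans hT.symm)
  · exact (congrArg _ hs).trans (by simp)

/-- The iposet obtained by adding a minimal element to the source interface. -/
def insertSource (P : Iposet α) (x : P.carrier) (hx : ∀ y, ¬ P.prec y x) : Iposet α :=
  { P with
    S := insert x P.S
    S_minimal := by
      rintro y (rfl | hy)
      · exact hx
      · exact P.S_minimal y hy }

theorem exists_isStartGluing_insertSource (s : Marking U P P.S) {x : P.carrier}
    (hx : ∀ y, ¬ P.prec y x) (t : Marking V (P.insertSource x hx) (P.insertSource x hx).S) :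
    ∃ a : U ⟶ V, Coface.B a = ∅ ∧ IsStartGluing s t a id := by
  have hmem : ∀ k, s.emb k ∈ (P.insertSource x hx).S := fun k => Or.inr (s.emb_mem k)
  choose g hg using fun k => t.exists_emb_eq (hmem k)
  have hmono : StrictMono g := fun i j hij => by
    rw [← t.event_emb_iff, hg, hg]
    exact s.event_emb_iff.2 hij
  have hlabel : ∀ i, V.label (g i) = U.label i := fun i => by
    rw [← t.label_emb, hg]
    exact s.label_emb i
  exact ⟨Coface.ofMap g hmono hlabel ∅ fun _ => Set.notMem_empty _, rfl,
    ⟨⟨⟨Function.injective_id, fun _ => rfl, id, fun _ => id⟩, id⟩, Function.surjective_id,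
      Set.image_id _, fun k => (hg k).symm⟩⟩

/-- The iposet obtained by removing an element. -/
def erase (P : Iposet α) (x : P.carrier) : Iposet α where
  carrier := {y : P.carrier // y ≠ x}
  finite := have := P.finite; inferInstance
  prec y z := P.prec y z
  event y z := P.event y z
  S := Subtype.val ⁻¹' P.S
  T := Subtype.val ⁻¹' P.T
  label y := P.label y
  prec_irrefl _ := P.prec_irrefl _
  prec_trans _ _ _ := P.prec_trans _ _ _
  event_irrefl _ := P.event_irrefl _
  event_trans _ _ _ := P.event_trans _ _ _
  comparable y z := by
    rw [Subtype.ext_iff]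
    exact P.comparable _ _
  S_minimal _ h _ := P.S_minimal _ h _
  T_maximal _ h _ := P.T_maximal _ h _

theorem exists_isEndGluing_erase (s : Marking U P P.S) {x : P.carrier} (hxS : x ∈ P.S)
    (hxT : x ∉ P.T) (hx : ∀ y ∉ P.S, P.prec x y) (t : Marking V (P.erase x) (P.erase x).S) :
    ∃ b : V ⟶ U, Coface.A b = ∅ ∧ IsEndGluing s t b Subtype.val := by
  choose g hg using fun k => s.exists_emb_eq (t.emb_mem k)
  have hmono : StrictMono g := fun i j hij => by
    rw [← s.event_emb_iff, hg, hg]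
    exact t.event_emb_iff.2 hij
  have hlabel : ∀ i, U.label (g i) = V.label i := fun i => by
    rw [← s.label_emb, hg]
    exact t.label_emb i
  obtain ⟨k, rfl⟩ := s.exists_emb_eq hxS
  have hB : (Set.range g)ᶜ = {k} := by
    ext i
    refine ⟨fun hi => ?_, ?_⟩
    · by_contra hik
      obtain ⟨l, hl⟩ := t.exists_emb_eq (x := ⟨s.emb i, s.emb_injective.ne hik⟩) (s.emb_mem i)
      exact hi ⟨l, s.emb_injective ((hg l).trans (congrArg Subtype.val hl))⟩
    · rintro rfl ⟨l, rfl⟩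
      exact (t.emb l).2 (hg l).symm
  refine ⟨Coface.ofMap g hmono hlabel (Set.range g)ᶜ fun i h => h ⟨i, rfl⟩, Set.sdiff_self,
    ⟨⟨Subtype.val_injective, fun _ => rfl, id, fun _ => id⟩, id⟩, ?_, hg, ?_, fun i hi y hy => ?_⟩
  · exact (Set.image_preimage_subset _ _).antisymm fun y hy =>
      ⟨⟨y, fun h => hxT (h ▸ hy)⟩, hy, rfl⟩
  · refine ((congrArg compl Subtype.range_val).trans (Set.compl_ne_eq_singleton _)).trans ?_
    exact (Set.image_singleton.symm.trans (congrArg _ hB.symm))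
  · obtain rfl : i = k := hB.subset hi
    exact hx y.1 hy

theorem IsInterval.exists_first_step (h : P.IsInterval) : (P.S = Set.univ ∧ P.T = Set.univ) ∨
    (∃ x ∉ P.S, ∀ y, ¬ P.prec y x) ∨ ∃ x ∈ P.S, x ∉ P.T ∧ ∀ y ∉ P.S, P.prec x y := by
  have := P.finite
  obtain ⟨b, e, hbe, hp⟩ := h
  by_cases hS : P.S = Set.univ
  · by_cases hT : P.T = Set.univ
    · exact Or.inl ⟨hS, hT⟩
    · obtain ⟨x, hx⟩ := (Set.ne_univ_iff_exists_notMem _).1 hT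
      exact Or.inr (Or.inr ⟨x, hS ▸ Set.mem_univ x, hx,
        fun y hy => (hy (hS ▸ Set.mem_univ y)).elim⟩)
  obtain ⟨x, hx, hmin⟩ := Set.exists_min_image P.Sᶜ b (Set.toFinite _) (Set.nonempty_compl.2 hS)
  by_cases hxm : ∃ y, P.prec y x
  · obtain ⟨y, hyx⟩ := hxm
    have heb := (hp y x).1 hyx
    have hyS : y ∈ P.S := by
      by_contra hyS
      exact ((hmin y hyS).trans (hbe y)).not_gt heb
    exact Or.inr (Or.inr ⟨y, hyS, fun hT => P.T_maximal y hT _ hyx,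
      fun z hz => (hp y z).2 (heb.trans_le (hmin z hz))⟩)
  · exact Or.inr (Or.inl ⟨x, hx, not_exists.1 hxm⟩)

theorem ncard_compl_S_insertSource_lt {x : P.carrier} (hx : ∀ y, ¬ P.prec y x) (hxS : x ∉ P.S) :
    (P.insertSource x hx).Sᶜ.ncard < P.Sᶜ.ncard :=
  have : Finite P.carrier := P.finite
  Set.ncard_lt_ncard (compl_lt_compl_iff_lt.2 (Set.ssubset_insert hxS)) (Set.toFinite P.Sᶜ)

theorem IsInterval.isRealized {U : LoSet α} {P : Iposet α} (s : Marking U P P.S)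
    (h : P.IsInterval) : IsRealized s := by
  rcases h.exists_first_step with ⟨hS, hT⟩ | ⟨x, _, hx⟩ | ⟨x, hxS, hxT, hx⟩
  · exact isRealized_of_eq_univ s hS hT
  · obtain ⟨V, ⟨t⟩⟩ := (P.insertSource x hx).exists_marking fun _ h _ => conc_of_mem_S h
    obtain ⟨a, ha, hj⟩ := exists_isStartGluing_insertSource s hx t
    exact .start ha hj (IsInterval.isRealized t h)
  · obtain ⟨V, ⟨t⟩⟩ := (P.erase x).exists_marking fun _ h _ => conc_of_mem_S h
    obtain ⟨b, hb, hj⟩ := exists_isEndGluing_erase s hxS hxT hx t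
    obtain ⟨b, e, hbe, hp⟩ := h
    exact .finish hb hj (IsInterval.isRealized t
      ⟨fun y => b y.1, fun y => e y.1, fun y => hbe _, fun y z => hp _ _⟩)
termination_by (Nat.card P.carrier, P.Sᶜ.ncard)
decreasing_by
  · exact Prod.Lex.right _ (ncard_compl_S_insertSource_lt hx ‹x ∉ P.S›)
  · have := P.finite
    exact Prod.Lex.left _ _ (Finite.card_subtype_lt (p := (· ≠ x)) (not_not.2 rfl))

theorem IsInterval.exists_stepWord (h : P.IsInterval) :
    ∃ (U W : LoSet α) (w : StepWord α U W), P.Isomorphic w.iposet := by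
  obtain ⟨U, ⟨s⟩⟩ := P.exists_marking fun _ h _ => conc_of_mem_S h
  obtain ⟨W, w, ⟨f, hf⟩, ⟨g, hg⟩⟩ := IsInterval.isRealized s h
  exact ⟨U, W, w, hf.subsumed.isomorphic hg.subsumed⟩

end Iposet

/-! ### Concatenation of words and gluing -/

namespace Iposet

variable {P Q R P₀ Q₀ R₀ A B : Iposet α}

theorem Isomorphic.refl (P : Iposet α) : P.Isomorphic P :=
  Setoid.refl P

theorem eq_of_range_eq_of_event {n : ℕ} {a b : Fin n → R.carrier}
    (ha : ∀ k l, k < l → R.event (a k) (a l)) (hb : ∀ k l, k < l → R.event (b k) (b l))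
    (h : Set.range a = Set.range b) : a = b := by
  have : IsStrictOrder R.carrier R.event :=
    { irrefl := R.event_irrefl
      trans := R.event_trans }
  let := partialOrderOfSO R.event
  exact (StrictMono.range_inj (fun k l => ha k l) fun k l => hb k l).1 h

namespace IsGluing

variable {i : P.carrier → R.carrier} {j : Q.carrier → R.carrier} {i₀ : P₀.carrier → R₀.carrier}
  {j₀ : Q₀.carrier → R₀.carrier}

/-- The identification of the interfaces in a gluing is unique, as these are linearly ordered by
the event order. Hence maps compatible with the interfaces are compatible with the gluings. -/
theorem eq_of_eq (g : IsGluing P₀ Q₀ R₀ i₀ j₀) (h : IsGluing P Q R i j)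
    {φ : P₀.carrier → P.carrier} {ψ : Q₀.carrier → Q.carrier} (hφ : IsLaxEmbedding P₀ P φ)
    (hψ : IsLaxEmbedding Q₀ Q ψ) (hT : φ '' P₀.T = P.T) (hS : ψ '' Q₀.S = Q.S) {x : P₀.carrier}
    {y : Q₀.carrier} (hxy : i₀ x = j₀ y) : i (φ x) = j (ψ y) := by
  obtain ⟨U, ⟨s⟩⟩ := P₀.exists_marking fun _ h _ => conc_of_mem_T h
  choose t htS ht using fun k => g.exists_right_eq (s.emb_mem k)
  have ht_range : Set.range t = Q₀.S := by
    rw [← g.right.injective.image_injective.eq_iff, ← g.image_T, ← s.range_emb, ← Set.range_comp,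
      ← Set.range_comp]
    exact congrArg Set.range (funext ht)
  have ht_event : ∀ k l, k < l → Q₀.event (t k) (t l) := fun k l hkl => by
    rw [← g.right.event_iff (conc_of_mem_S (htS k) (htS l)), ht, ht,
      g.left.event_iff (conc_of_mem_T (s.emb_mem k) (s.emb_mem l))]
    exact s.event_emb_iff.2 hkl
  have key : (fun k => i (φ (s.emb k))) = fun k => j (ψ (t k)) := by
    refine eq_of_range_eq_of_event (fun k l hkl => ?_) (fun k l hkl => ?_) ?_
    · have hc := conc_of_mem_T (s.emb_mem k) (s.emb_mem l)
      exact h.left.event (hφ.conc hc) (hφ.event hc (s.event_emb_iff.2 hkl))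
    · have hc := conc_of_mem_S (htS k) (htS l)
      exact h.right.event (hψ.conc hc) (hψ.event hc (ht_event k l hkl))
    · rw [Set.range_comp' i, Set.range_comp' φ, Set.range_comp' j, Set.range_comp' ψ, s.range_emb,
        ht_range, hT, hS, h.image_T]
  obtain ⟨k, rfl⟩ := s.exists_emb_eq (g.inter hxy)
  obtain rfl : t k = y := g.right.injective ((ht k).trans hxy)
  exact congrFun key k

theorem subsumed (g : IsGluing P₀ Q₀ R₀ i₀ j₀) (h : IsGluing P Q R i j) (hP : P₀.Subsumed P)
    (hQ : Q₀.Subsumed Q) : R₀.Subsumed R := by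
  obtain ⟨φ, hφ⟩ := hP
  obtain ⟨ψ, hψ⟩ := hQ
  obtain ⟨e, hei, hej⟩ := g.exists_desc (f := i ∘ φ) (g := j ∘ ψ) fun _ _ =>
    g.eq_of_eq h hφ.isLaxEmbedding hψ.isLaxEmbedding hφ.tgt hψ.src
  have hei' : ∀ x, e (i₀ x) = i (φ x) := congrFun hei
  have hej' : ∀ y, e (j₀ y) = j (ψ y) := congrFun hej
  have he : IsLaxEmbedding R₀ R e := by
    refine g.isLaxEmbedding_desc (hei ▸ h.left.toIsLaxEmbedding.comp hφ.isLaxEmbedding)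
      (hej ▸ h.right.toIsLaxEmbedding.comp hψ.isLaxEmbedding) (fun x hx y hxy => hx ?_)
      fun x y => by rw [hei', hej']; exact h.not_prec _ _
    rw [hei', hej'] at hxy
    exact φ.injective.mem_set_image.1 (hφ.tgt.superset (h.inter hxy))
  have hsurj : Function.Surjective e := fun r => by
    rcases h.cover r with ⟨x, rfl⟩ | ⟨y, rfl⟩
    · exact ⟨i₀ (φ.symm x), by rw [hei', φ.apply_symm_apply]⟩
    · exact ⟨j₀ (ψ.symm y), by rw [hej', ψ.apply_symm_apply]⟩
  have hS : e '' R₀.S = R.S := by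
    rw [← g.src, ← Set.image_comp, hei, Set.image_comp, hφ.src, h.src]
  have hT : e '' R₀.T = R.T := by
    rw [← g.tgt, ← Set.image_comp, hej, Set.image_comp, hψ.tgt, h.tgt]
  exact ⟨Equiv.ofBijective e ⟨he.injective, hsurj⟩, hS, hT, he.label, fun _ _ => he.prec,
    fun _ _ hxy h₁ h₂ => he.event ⟨h₁, h₂⟩ hxy⟩

theorem isomorphic {i₀ : P.carrier → R₀.carrier} {j₀ : Q.carrier → R₀.carrier}
    (g : IsGluing P Q R₀ i₀ j₀) (h : IsGluing P Q R i j) :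
    R₀.Isomorphic R :=
  have hP := (Isomorphic.refl P).subsumed
  have hQ := (Isomorphic.refl Q).subsumed
  (g.subsumed h hP hQ).isomorphic (h.subsumed g hP hQ)

theorem nil {V : LoSet α} (q : Marking V Q Q.S) :
    IsGluing (discrete V Set.univ Set.univ) Q Q q.emb id where
  left := q.isEmbedding_emb _ _
  right := .id Q
  image_T := Set.image_univ.trans (q.range_emb.trans (Set.image_id _).symm)
  inter _ := Set.mem_univ _
  cover r := Or.inr ⟨r, rfl⟩
  prec hx := (hx (Set.mem_univ _)).elim
  src := Set.image_univ.trans q.range_emb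
  tgt := Set.image_id _

theorem assoc {k₁ : P₀.carrier → A.carrier} {k₂ : P.carrier → A.carrier}
    {l₁ : P₀.carrier → B.carrier} {l₂ : R.carrier → B.carrier} (h : IsGluing P Q R i j)
    (k : IsGluing P₀ P A k₁ k₂) (l : IsGluing P₀ R B l₁ l₂) : ∃ m, IsGluing A Q B m (l₂ ∘ j) := by
  obtain ⟨m, rfl, hm₂⟩ := k.exists_desc (f := l₁) (g := l₂ ∘ i) fun _ _ =>
    k.eq_of_eq l (IsEmbedding.id P₀).toIsLaxEmbedding h.left.toIsLaxEmbedding (Set.image_id _) h.src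
  have hm₂' : ∀ p, m (k₂ p) = l₂ (i p) := congrFun hm₂
  have hS : ∀ p, i p ∈ R.S ↔ p ∈ P.S := fun p => by rw [← h.src, h.left.injective.mem_set_image]
  have hT : ∀ p, k₂ p ∈ A.T ↔ p ∈ P.T := fun p => by rw [← k.tgt, k.right.injective.mem_set_image]
  refine ⟨m, k.isEmbedding_desc l.left (hm₂ ▸ l.right.comp h.left) (fun x hx p hxp => ?_)
    (fun x p => ?_) (fun x hx p hp => ?_), l.right.comp h.right, ?_, fun {a y} hay => ?_,
    fun r => ?_, fun {a y} ha hy => ?_, ?_, ?_⟩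
  · exact hx (l.inter (hxp.trans (hm₂' p)))
  · exact hm₂' p ▸ l.not_prec x _
  · exact hm₂' p ▸ l.prec hx ((hS p).not.2 hp)
  · rw [← k.tgt, ← Set.image_comp, hm₂, Set.image_comp, h.image_T, Set.image_comp]
  · rcases k.cases_right a with ⟨p, rfl⟩ | ⟨x, hx, rfl⟩
    · exact (hT p).2 (h.inter (l.right.injective ((hm₂' p).symm.trans hay)))
    · exact (hx (l.inter hay)).elim
  · rcases l.cover r with ⟨x, rfl⟩ | ⟨r, rfl⟩
    · exact Or.inl ⟨k₁ x, rfl⟩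
    · exact (h.cover r).imp (fun ⟨p, hp⟩ => ⟨k₂ p, hp ▸ hm₂' p⟩) fun ⟨y, hy⟩ => ⟨y, hy ▸ rfl⟩
  · rcases k.cases_right a with ⟨p, rfl⟩ | ⟨x, hx, rfl⟩
    · exact hm₂' p ▸ l.right.map_prec (h.prec ((hT p).not.1 ha) hy)
    · refine l.prec hx fun hyS => hy ?_
      obtain ⟨p, -, hp⟩ := h.src.superset hyS
      exact h.mem_S_of_eq hp
  · rw [← k.src, ← Set.image_comp, l.src]
  · rw [Set.image_comp, h.tgt, l.tgt]

end IsGluing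

end Iposet

namespace StepWord

open Iposet

variable {U V V' W : LoSet α} {P Q : Iposet α}

theorem exists_isGluing_append (w : StepWord α U V) (v : StepWord α V W) :
    ∃ i j, IsGluing w.iposet v.iposet (w.append v).iposet i j := by
  induction w with
  | nil V => exact ⟨_, _, .nil v.src⟩
  | up a ha w ih =>
    obtain ⟨i, j, h⟩ := ih v
    exact (h.assoc (isGluing_glue _) (isGluing_glue _)).imp fun _ hm => ⟨_, hm⟩
  | down b hb w ih =>
    obtain ⟨i, j, h⟩ := ih v
    exact (h.assoc (isGluing_glue _) (isGluing_glue _)).imp fun _ hm => ⟨_, hm⟩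

theorem nonempty_marking_T (w : StepWord α U V) : Nonempty (Marking V w.iposet w.iposet.T) := by
  induction w with
  | nil V => exact ⟨Marking.univ V _ _⟩
  | up a ha w ih => exact ih.map fun t => t.image (isEmbedding_inR _) fun _ h _ => conc_of_mem_T h
  | down b hb w ih => exact ih.map fun t => t.image (isEmbedding_inR _) fun _ h _ => conc_of_mem_T h

theorem eq_of_matching {w : StepWord α U V} {v : StepWord α V' W} (hP : P.Subsumed w.iposet)
    (hQ : Q.Subsumed v.iposet) (f : Matching P Q) : V = V' := by
  obtain ⟨φ, hφ⟩ := hP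
  obtain ⟨ψ, hψ⟩ := hQ
  obtain ⟨t⟩ := w.nonempty_marking_T
  let eT : P.T ≃ w.iposet.T := φ.subtypeEquiv fun x => by rw [← hφ.tgt, φ.injective.mem_set_image]
  let eS : Q.S ≃ v.iposet.S := ψ.subtypeEquiv fun x => by rw [← hψ.src, ψ.injective.mem_set_image]
  refine (t.eq_of_iso v.src ((eT.symm.trans f.equiv).trans eS) (fun x y hxy => ?_) fun x => ?_).1
  · obtain ⟨x, rfl⟩ := eT.surjective x
    obtain ⟨y, rfl⟩ := eT.surjective y
    have hPxy := (hφ.isLaxEmbedding.event_iff (conc_of_mem_T x.2 y.2)).1 hxy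
    simp only [Equiv.trans_apply, Equiv.symm_apply_apply]
    exact hψ.isLaxEmbedding.event (conc_of_mem_S (f.equiv x).2 (f.equiv y).2)
      ((f.event_iff x y).1 hPxy)
  · obtain ⟨x, rfl⟩ := eT.surjective x
    simp only [Equiv.trans_apply, Equiv.symm_apply_apply]
    exact (hψ.label _).trans ((f.label_eq x).trans (hφ.label x).symm)

end StepWord

/-! ### The language of the automaton -/

theorem HPath.evAux_eq {X : PrecubicalSet α} {x y : Cell X} (p : HPath X x y) :
    p.evAux = p.word.evAux := by
  induction p with
  | nil x => rfl
  | cons s p ih => cases s <;> rw [evAux, ih] <;> rfl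

theorem HPath.ev_eq {X : PrecubicalSet α} {x y : Cell X} (p : HPath X x y) :
    p.ev = Ipomset.mk p.word.iposet := by
  rw [HPath.ev, HPath.evAux_eq]

namespace Ipomset

theorem IsInterval.exists_stepWord {R : Ipomset α} (h : R.IsInterval) :
    ∃ (U W : LoSet α) (w : StepWord α U W), R = mk w.iposet := by
  induction R using Quotient.inductionOn with
  | h P =>
    obtain ⟨U, W, w, hw⟩ := Iposet.IsInterval.exists_stepWord (P := P) h
    exact ⟨U, W, w, Quotient.sound hw⟩

theorem Subsumed.refl (P : Ipomset α) : P.Subsumed P := by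
  induction P using Quotient.inductionOn with
  | h P => exact (Iposet.Isomorphic.refl P).subsumed

theorem Subsumed.trans {P Q R : Ipomset α} : P.Subsumed Q → Q.Subsumed R → P.Subsumed R := by
  induction P using Quotient.inductionOn
  induction Q using Quotient.inductionOn
  induction R using Quotient.inductionOn
  exact Iposet.Subsumed.trans

end Ipomset

namespace HDA

open Ipomset

variable (X : HDA α)

theorem mem_lang_iff {R : Ipomset α} :
    R ∈ X.lang ↔ ∃ (U W : LoSet α) (w : StepWord α U W) (x : X.cells.obj (op U)),
      (⟨U, x⟩ : Cell X.cells) ∈ X.start ∧ Accepts X.cells X.accept w x ∧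
        R = Ipomset.mk w.iposet := by
  constructor
  · rintro ⟨x, hx, y, hy, p, rfl⟩
    exact ⟨x.1, y.1, p.word, x.2, hx, .of_path p hy, p.ev_eq⟩
  · rintro ⟨U, W, w, x, hx, hw, rfl⟩
    obtain ⟨y, hy, p, rfl⟩ := Accepts.exists_path w x hw
    exact ⟨_, hx, _, hy, p, p.ev_eq⟩

/-- The ipomset `R` is subsumed by the ipomset of a concatenation of `n + 1` words, each leading
from a start cell to an accept cell. -/
def PowSubsumes (n : ℕ) (R : Ipomset α) : Prop :=
  ∃ (U W : LoSet α) (w : StepWord α U W) (x : X.cells.obj (op U)),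
    (⟨U, x⟩ : Cell X.cells) ∈ X.start ∧ PowAccepts X n w x ∧ R.Subsumed (Ipomset.mk w.iposet)

variable {X}

theorem PowSubsumes.of_subsumed {n : ℕ} {R R' : Ipomset α} (h : R.Subsumed R')
    (h' : X.PowSubsumes n R') : X.PowSubsumes n R := by
  obtain ⟨U, W, w, x, hx, hw, hR'⟩ := h'
  exact ⟨U, W, w, x, hx, hw, h.trans hR'⟩

theorem mem_lang_iff_powSubsumes_zero {R : Ipomset α} :
    R ∈ X.lang ↔ R.IsInterval ∧ X.PowSubsumes 0 R := by
  rw [mem_lang_iff]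
  constructor
  · rintro ⟨U, W, w, x, hx, hw, rfl⟩
    exact ⟨w.isInterval, U, W, w, x, hx, hw, .refl _⟩
  · rintro ⟨hR, U, W, v, x, hx, hv, hRv⟩
    obtain ⟨U', W', w, rfl⟩ := hR.exists_stepWord
    obtain ⟨rfl, h⟩ := (StepWord.subsumed_iff_align w v).1 hRv
    exact ⟨_, _, w, x, hx, by simpa using Accepts.of_align h x hv, rfl⟩

theorem PowSubsumes.of_isGluing {n : ℕ} {P Q R : Ipomset α} (h : IsGluing P Q R)
    (hP : P ∈ X.lang) (hQ : X.PowSubsumes n Q) : X.PowSubsumes (n + 1) R := by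
  obtain ⟨p, q, f, rfl, rfl, rfl⟩ := h
  obtain ⟨U, V, w, x, hx, hw, hpw⟩ := X.mem_lang_iff.1 hP
  obtain ⟨V', W, v, y, hy, hv, hqv⟩ := hQ
  have hpw' : p.Subsumed w.iposet := (Quotient.exact hpw).subsumed
  obtain rfl := StepWord.eq_of_matching hpw' hqv f
  obtain ⟨i, j, hg⟩ := w.exists_isGluing_append v
  exact ⟨U, W, _, x, hx, ⟨_, w, v, y, rfl, hw, hy, hv⟩,
    (Iposet.isGluing_glue f).subsumed hg hpw' hqv⟩

theorem PowSubsumes.exists_isGluing {n : ℕ} {R : Ipomset α} (h : X.PowSubsumes (n + 1) R) :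
    ∃ P ∈ X.lang, ∃ Q, Q.IsInterval ∧ X.PowSubsumes n Q ∧
      ∃ R', IsGluing P Q R' ∧ R.Subsumed R' := by
  obtain ⟨U, W, _, x, hx, ⟨V, w, v, y, rfl, hw, hy, hv⟩, hR⟩ := h
  obtain ⟨t⟩ := w.nonempty_marking_T
  obtain ⟨i, j, hg⟩ := w.exists_isGluing_append v
  have h : IsGluing (Ipomset.mk w.iposet) (Ipomset.mk v.iposet)
      (Ipomset.mk (w.append v).iposet) :=
    ⟨w.iposet, v.iposet, t.matching v.src, rfl, rfl,
      Quotient.sound ((Iposet.isGluing_glue _).isomorphic hg)⟩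
  exact ⟨_, X.mem_lang_iff.2 ⟨U, V, w, x, hx, hw, rfl⟩, Ipomset.mk v.iposet, v.isInterval,
    ⟨V, W, v, y, hy, hv, .refl _⟩, _, h, hR⟩

theorem mem_langPow_iff {n : ℕ} {R : Ipomset α} :
    R ∈ langPow X.lang n ↔ R.IsInterval ∧ X.PowSubsumes n R := by
  induction n generalizing R with
  | zero => exact mem_lang_iff_powSubsumes_zero
  | succ n ih =>
    constructor
    · rintro ⟨hR, R', ⟨P, hP, Q, hQ, h⟩, hRR'⟩
      exact ⟨hR, (PowSubsumes.of_isGluing h hP (ih.1 hQ).2).of_subsumed hRR'⟩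
    · rintro ⟨hR, h⟩
      obtain ⟨P, hP, Q, hQ, hQ', R', hR', hRR'⟩ := h.exists_isGluing
      exact ⟨hR, R', ⟨P, hP, Q, ih.2 ⟨hQ, hQ'⟩, hR'⟩, hRR'⟩

theorem mem_kleenePlus_iff {R : Ipomset α} :
    R ∈ kleenePlus X.lang ↔ R.IsInterval ∧ ∃ n, X.PowSubsumes n R := by
  simp only [kleenePlus, Set.mem_iUnion, mem_langPow_iff, exists_and_left]

variable (X) in
theorem plus_lang : X.plus.lang = kleenePlus X.lang := by
  ext R
  rw [mem_kleenePlus_iff, mem_lang_iff]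
  constructor
  · rintro ⟨U, W, w, x, hx, hw, rfl⟩
    obtain ⟨y, V, v, n, hy, hv, h⟩ := (exists_accepts_laxCells_iff w).1 ⟨x, hx, hw⟩
    exact ⟨w.isInterval, n, U, V, v, y, hy, hv, (StepWord.subsumed_iff_align w v).2 ⟨rfl, h⟩⟩
  · rintro ⟨hR, n, U, V, v, y, hy, hv, hRv⟩
    obtain ⟨U', W', w, rfl⟩ := hR.exists_stepWord
    obtain ⟨rfl, h⟩ := (StepWord.subsumed_iff_align w v).1 hRv
    obtain ⟨x, hx, hw⟩ := (exists_accepts_laxCells_iff w).2 ⟨y, V, v, n, hy, hv, h⟩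
    exact ⟨_, _, w, x, hx, hw, rfl⟩

end HDA

end HDALang

theorem mainTheorem9 {α : Type u} (L : Set (HDALang.Ipomset α)) (hL : HDALang.IsRegular L) :
    HDALang.Ipomset.IsLanguage (HDALang.Ipomset.kleenePlus L) ∧
      HDALang.IsRegular (HDALang.Ipomset.kleenePlus L) := by
  obtain ⟨X, rfl⟩ := hL
  refine ⟨⟨fun P hP => (HDALang.HDA.mem_kleenePlus_iff.1 hP).1, fun P Q hP hPQ hQ => ?_⟩,
    X.plus, X.plus_lang⟩
  obtain ⟨-, n, hn⟩ := HDALang.HDA.mem_kleenePlus_iff.1 hQ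
  exact HDALang.HDA.mem_kleenePlus_iff.2 ⟨hP, n, hn.of_subsumed hPQ⟩
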